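/- Let $\xi=(\xi_1,\dots,\xi_p)$ and $\eta=(\eta_1,\dots,\eta_q)$ be jointly Gaussian real random vectors with nonsingular covariance matrices $R_\xi,R_\eta$ and cross-covariance matrix $R_{\xi\eta}$ of rank $r\ge 2$, such that the joint law $P_{\xi\eta}$ is absolutely continuous with respect to $P_\xi\otimes P_\eta$. Let $i(\xi;\eta)=\log\frac{dP_{\xi\eta}}{d(P_\xi\otimes P_\eta)}(\xi,\eta)$ be the information density and $I=\mathbb{E}\,i(\xi;\eta)$ the mutual information. Let $\rho_1\ge\dots\ge\rho_r>0$ be the positive canonical correlations of $\xi,\eta$, i.e. the positive singular values of $R_\xi^{-1/2}R_{\xi\eta}R_\eta^{-1/2}$. Let $K_\alpha$ be the modified Bessel function of the second kind and $L_\alpha$ the modified Struve function of order $\alpha$. For $k\in\mathbb{N}_0$ put $$U_k(z)=\frac{K_{\frac{r-1}{2}+k}(z)}{\Gamma(\frac r2+k)}\Big(\frac z2\Big)^{\frac{r-1}{2}+k}\ (z>0),\qquad U_k(0)=\lim_{z\to0+}U_k(z)=\frac{\Gamma(\frac{r-1}{2}+k)}{2\,\Gamma(\frac r2+k)},$$ $$D_k(z)=\frac{z}{2\rho_r}\Big[K_{\frac{r-1}{2}+k}\big(\tfrac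 z{\rho_r}\big)L_{\frac{r-3}{2}+k}\big(\tfrac z{\rho_r}\big)+K_{\frac{r-3}{2}+k}\big(\tfrac z{\rho_r}\big)L_{\frac{r-1}{2}+k}\big(\tfrac z{\rho_r}\big)\Big]\ (z>0),\qquad D_k(0)=0,$$ $$\delta_k=\sum_{k_1+\dots+k_{r-1}=k}\ \prod_{i=1}^{r-1}\frac{(2k_i)!}{(k_i!)^2\,4^{k_i}}\Big(1-\frac{\rho_r^2}{\rho_i^2}\Big)^{k_i},$$ the sum being over $(k_1,\dots,k_{r-1})\in\mathbb{N}_0^{r-1}$, and with $0^0=1$. For $\kappa=(k_1,\dots,k_{r-1})\in\mathbb{N}_0^{r-1}$ write $|\kappa|=k_1+\dots+k_{r-1}$ and $$c_\kappa=\prod_{i=1}^{r-1}\frac{\rho_r}{\rho_i}\,\frac{(2k_i)!}{(k_i!)^2\,4^{k_i}}\Big(1-\frac{\rho_r^2}{\rho_i^2}\Big)^{k_i}.$$ Then $i(\xi;\eta)$ is integrable, and the following hold. (i) The law of $i(\xi;\eta)$ has a continuous density $f$ with respect to Lebesgue measure on $\mathbb{R}$. For every $x\neq I$, $$f(x)=\frac1{\rho_r\sqrt\pi}\sum_{\kappa\in\mathbb{N}_0^{r-1}}c_\kappa\,\frac{K_{\frac{r-1}2+|\kappa|}\big(\big|\tfrac{x-I}{\rho_r}\big|\big)}{\Gamma(\frac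 r2+|\kappa|)}\Big|\frac{x-I}{2\rho_r}\Big|^{\frac{r-1}2+|\kappa|},$$ and for every $x\in\mathbb{R}$ it has the alternative representation by a convergent single series $$f(x)=\frac{1}{\rho_r\sqrt\pi}\Big(\prod_{i=1}^{r-1}\frac{\rho_r}{\rho_i}\Big)\sum_{k=0}^\infty\delta_k\,U_k\Big(\Big|\frac{x-I}{\rho_r}\Big|\Big).$$ (ii) The distribution function $F$ of $i(\xi;\eta)$ satisfies $F(x)=\frac12-V(I-x)$ for $x\le I$ and $F(x)=\frac12+V(x-I)$ for $x>I$, where for every $z\ge0$ (each summand being read as $0$ at $z=0$) $$V(z)=\sum_{\kappa\in\mathbb{N}_0^{r-1}}c_\kappa\,\frac z{2\rho_r}\Big[K_{\frac{r-1}2+|\kappa|}\big(\tfrac z{\rho_r}\big)L_{\frac{r-3}2+|\kappa|}\big(\tfrac z{\rho_r}\big)+K_{\frac{r-3}2+|\kappa|}\big(\tfrac z{\rho_r}\big)L_{\frac{r-1}2+|\kappa|}\big(\tfrac z{\rho_r}\big)\Big],$$ and this function has, for every $z\ge0$, the alternative representation by a convergent single series $$V(z)=\Big(\prod_{i=1}^{r-1}\frac{\rho_r}{\rho_i}\Big)\sum_{k=0}^\infty\delta_k\,D_k(z).$$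 -/

import Mathlib

open MeasureTheory ProbabilityTheory
open scoped Nat

namespace GaussInfo

noncomputable section

/-- The cross-covariance matrix of two random vectors. -/
def crossCov {Ω : Type*} [MeasurableSpace Ω] (P : Measure Ω) {p q : ℕ}
    (ξ : Ω → Fin p → ℝ) (η : Ω → Fin q → ℝ) : Matrix (Fin p) (Fin q) ℝ :=
  Matrix.of fun i j => cov[fun ω => ξ ω i, fun ω => η ω j; P]

/-- The covariance matrix of a random vector. -/
def covMat {Ω : Type*} [MeasurableSpace Ω] (P : Measure Ω) {p : ℕ}
    (ξ : Ω → Fin p → ℝ) : Matrix (Fin p) (Fin p) ℝ :=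
  crossCov P ξ ξ

/-- The inverse square root `(R ^ (1/2))⁻¹` of a symmetric positive definite matrix `R`, where the
square root is obtained by applying `√` to the eigenvalues of `R`. -/
def invSqrt {p : ℕ} (R : Matrix (Fin p) (Fin p) ℝ) : Matrix (Fin p) (Fin p) ℝ :=
  (cfc Real.sqrt R)⁻¹

/-- The canonical correlations of `ξ` and `η`, in descending order: the singular values of
`R_ξ ^ (-1/2) * R_ξη * R_η ^ (-1/2)`. The index starts at `0`, so that `ρ_i` of the usual
numbering `ρ_1 ≥ ρ_2 ≥ … ≥ ρ_r > 0` is `canonicalCorr P ξ η (i - 1)`; the values with index at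
least the rank of `R_ξη` are `0`. -/
def canonicalCorr {Ω : Type*} [MeasurableSpace Ω] (P : Measure Ω) {p q : ℕ}
    (ξ : Ω → Fin p → ℝ) (η : Ω → Fin q → ℝ) (i : ℕ) : ℝ :=
  (Matrix.toEuclideanLin
    (invSqrt (covMat P ξ) * crossCov P ξ η * invSqrt (covMat P η))).singularValues i

/-- The information density of `ξ` and `η`: the logarithm of the Radon-Nikodym derivative of the
joint law with respect to the product of the marginal laws, evaluated at `(ξ, η)`. -/
def infoDensity {Ω : Type*} [MeasurableSpace Ω] (P : Measure Ω) {p q : ℕ}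
    (ξ : Ω → Fin p → ℝ) (η : Ω → Fin q → ℝ) (ω : Ω) : ℝ :=
  Real.log (((P.map fun ω' => (ξ ω', η ω')).rnDeriv ((P.map ξ).prod (P.map η))
    (ξ ω, η ω)).toReal)

/-- The mutual information of `ξ` and `η`: the expectation of the information density. -/
def mutualInfo {Ω : Type*} [MeasurableSpace Ω] (P : Measure Ω) {p q : ℕ}
    (ξ : Ω → Fin p → ℝ) (η : Ω → Fin q → ℝ) : ℝ :=
  ∫ ω, infoDensity P ξ η ω ∂P

/-- The modified Bessel function of the second kind `K_α(z)`, for real order `α` and `z > 0`. -/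
def besselK (α z : ℝ) : ℝ :=
  ∫ t in Set.Ioi (0 : ℝ), Real.exp (-z * Real.cosh t) * Real.cosh (α * t)

/-- The modified Struve function `L_α(z)`, for real order `α` and `z ≥ 0`. (`Real.Gamma` is `0` at
its poles, so that `1 / Γ` vanishes there, as it should.) -/
def struveL (α z : ℝ) : ℝ :=
  (z / 2) ^ (α + 1) *
    ∑' n : ℕ, (z / 2) ^ (2 * n) / (Real.Gamma (n + 3 / 2) * Real.Gamma (n + α + 3 / 2))

/-- `U_k(z) = K_{(r-1)/2+k}(z) / Γ(r/2+k) * (z/2) ^ ((r-1)/2+k)` for `z > 0`, with its limit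
`Γ((r-1)/2+k) / (2 Γ(r/2+k))` as the value at `z = 0`. -/
def funU (r k : ℕ) (z : ℝ) : ℝ :=
  if z = 0 then
    Real.Gamma (((r : ℝ) - 1) / 2 + k) / (2 * Real.Gamma ((r : ℝ) / 2 + k))
  else
    besselK (((r : ℝ) - 1) / 2 + k) z / Real.Gamma ((r : ℝ) / 2 + k) *
      (z / 2) ^ (((r : ℝ) - 1) / 2 + k)

/-- `D_k(z) = z/(2s) * [K_{(r-1)/2+k}(z/s) L_{(r-3)/2+k}(z/s) + K_{(r-3)/2+k}(z/s) L_{(r-1)/2+k}(z/s)]`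
with `s` in the role of the smallest positive canonical correlation. The value at `z = 0` is `0`. -/
def funD (r : ℕ) (s : ℝ) (k : ℕ) (z : ℝ) : ℝ :=
  z / (2 * s) *
    (besselK (((r : ℝ) - 1) / 2 + k) (z / s) * struveL (((r : ℝ) - 3) / 2 + k) (z / s) +
      besselK (((r : ℝ) - 3) / 2 + k) (z / s) * struveL (((r : ℝ) - 1) / 2 + k) (z / s))

/-- The coefficient `δ_k`, a sum over all `(k_1, …, k_{r-1})` with `k_1 + ⋯ + k_{r-1} = k`;
`ρ i` is the canonical correlation number `i + 1`, and `ρ (r - 1)` is the last one. -/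
def delta (r : ℕ) (ρ : ℕ → ℝ) (k : ℕ) : ℝ :=
  ∑ κ ∈ Finset.Nat.antidiagonalTuple (r - 1) k,
    ∏ i : Fin (r - 1), (((2 * κ i)! : ℕ) : ℝ) / (((κ i)! : ℝ) ^ 2 * 4 ^ κ i) *
      (1 - ρ (r - 1) ^ 2 / ρ i ^ 2) ^ κ i

/-- The bracketed product in the multiple series, for the multi-index `(k_1, …, k_{r-1})`. -/
def multiCoeff (r : ℕ) (ρ : ℕ → ℝ) (κ : Fin (r - 1) → ℕ) : ℝ :=
  ∏ i : Fin (r - 1), ρ (r - 1) / ρ i *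
    ((((2 * κ i)! : ℕ) : ℝ) / (((κ i)! : ℝ) ^ 2 * 4 ^ κ i)) *
      (1 - ρ (r - 1) ^ 2 / ρ i ^ 2) ^ κ i

end

end GaussInfo

/-! Whiten `ξ` and `η` and diagonalize the symmetric block matrix with off-diagonal blocks `M` and
`Mᵀ`, where `M` is the whitened cross-covariance. In the resulting coordinates `w` the product of
the marginals is standard Gaussian and the joint law is a product of Gaussians `N(0, 1 + λ_j)`, with
`λ_j` the eigenvalues of the block matrix (`map_diagCoord_prod`, `map_diagCoord_joint`). Absolute
continuity forces `1 + λ_j > 0`. Hence the information density is a constant plus `∑ ½ (1 - 1/(1 +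
λ_j)) w_j²`. The quadratic form has mean `½ ∑ λ_j = 0`, because the block matrix has trace zero, so
the constant is `I`.

The square of the characteristic function of `i - I` is `∏ (1 - i t λ_j)⁻¹`, which a Schur
complement turns into `∏ (1 + ρ_i² t²)⁻¹`. Continuity and the value at `0` fix the sign of the root
(`charFun_infoDensity_sub`).

On the analytic side, a Gaussian of variance `2g` with `g` Gamma distributed of shape `ν + 1/2` has
the Bessel density `besselDensity ν` and characteristic function `(1 + t²)^(-(ν + 1/2))`. Scaling by
`ρ_r` and expanding each factor in a binomial series in `1/(1 + t²)` shows that `(i - I)/ρ_r` is a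
mixture of these laws, with the nonnegative weights `multiCoeff` of total mass one
(`hasSum_multiCoeff_mul_rpow`, `charFun_mixMeasure`). The bound `besselDensity_le_one`, uniform in
the order, makes the density series converge uniformly and permits termwise integration. Each
integral is a Bessel–Struve expression by `integral_besselInt`. The single series arise by grouping
multi-indices of equal sum. -/

namespace GaussInfo

open Set Filter Topology

/-! ### Bessel integrals of the second kind. -/

/-- The integral `∫₀^∞ g ^ (ν - 1) e ^ (-g - z² / (4g)) dg`, which is `2 (z/2) ^ ν K_ν(z)`. -/
noncomputable def besselInt (ν z : ℝ) : ℝ :=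
  ∫ g in Ioi (0 : ℝ), g ^ (ν - 1) * Real.exp (-g - z ^ 2 / (4 * g))

lemma aestronglyMeasurable_besselInt_integrand (ν z : ℝ) (μ : Measure ℝ) :
    AEStronglyMeasurable (fun g : ℝ => g ^ (ν - 1) * Real.exp (-g - z ^ 2 / (4 * g))) μ :=
  (Measurable.mul (by fun_prop) (by fun_prop)).aestronglyMeasurable

lemma integrableOn_rpow_mul_exp_neg {ν : ℝ} (hν : 0 < ν) :
    IntegrableOn (fun g : ℝ => g ^ (ν - 1) * Real.exp (-g)) (Ioi 0) := by
  simpa only [mul_comm] using Real.GammaIntegral_convergent hν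

lemma integral_rpow_mul_exp_neg {ν : ℝ} (hν : 0 < ν) :
    ∫ g in Ioi (0 : ℝ), g ^ (ν - 1) * Real.exp (-g) = Real.Gamma ν := by
  simpa only [mul_comm] using (Real.Gamma_eq_integral hν).symm

lemma integrableOn_besselInt_of_pos {ν : ℝ} (hν : 0 < ν) (z : ℝ) :
    IntegrableOn (fun g : ℝ => g ^ (ν - 1) * Real.exp (-g - z ^ 2 / (4 * g))) (Ioi 0) := by
  refine (integrableOn_rpow_mul_exp_neg hν).mono'
    (aestronglyMeasurable_besselInt_integrand ν z _) ?_
  filter_upwards [ae_restrict_mem measurableSet_Ioi] with g (hg : 0 < g)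
  rw [Real.norm_of_nonneg (by positivity)]
  have : 0 ≤ z ^ 2 / (4 * g) := by positivity
  gcongr
  linarith

/-- For nonpositive `ν` the singularity at `g = 0` is killed by `exp (-z²/(4g))`, which is at most a
constant times `g ^ m` for every `m`; any `m > -ν` reduces to a Gamma integral. -/
lemma integrableOn_besselInt (ν : ℝ) {z : ℝ} (hz : z ≠ 0) :
    IntegrableOn (fun g : ℝ => g ^ (ν - 1) * Real.exp (-g - z ^ 2 / (4 * g))) (Ioi 0) := by
  obtain ⟨m, hm⟩ := exists_nat_gt (-ν)
  have hz2 : 0 < z ^ 2 / 4 := by positivity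
  refine ((integrableOn_rpow_mul_exp_neg (ν := ν + m) (by linarith)).const_mul
    (m ! / (z ^ 2 / 4) ^ m)).mono' (aestronglyMeasurable_besselInt_integrand ν z _) ?_
  filter_upwards [ae_restrict_mem measurableSet_Ioi] with g (hg : 0 < g)
  rw [Real.norm_of_nonneg (by positivity)]
  have hx : 0 < z ^ 2 / 4 / g := by positivity
  have h1 := Real.pow_div_factorial_le_exp _ hx.le m
  have h2 : Real.exp (-(z ^ 2 / 4 / g)) ≤ m ! / (z ^ 2 / 4) ^ m * g ^ m := by
    rw [Real.exp_neg]
    refine (inv_anti₀ (by positivity) h1).trans_eq ?_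
    rw [inv_div, div_pow]
    field_simp
  calc g ^ (ν - 1) * Real.exp (-g - z ^ 2 / (4 * g))
      = g ^ (ν - 1) * (Real.exp (-g) * Real.exp (-(z ^ 2 / 4 / g))) := by
        rw [← Real.exp_add]; congr 2; field_simp; ring
    _ ≤ g ^ (ν - 1) * (Real.exp (-g) * (m ! / (z ^ 2 / 4) ^ m * g ^ m)) := by gcongr
    _ = _ := by
        rw [show ν + m - 1 = ν - 1 + m by ring, Real.rpow_add_natCast hg.ne']; ring

lemma besselInt_nonneg (ν z : ℝ) : 0 ≤ besselInt ν z :=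
  setIntegral_nonneg measurableSet_Ioi fun g (hg : 0 < g) => by positivity

lemma besselInt_zero {ν : ℝ} (hν : 0 < ν) : besselInt ν 0 = Real.Gamma ν := by
  simpa [besselInt] using integral_rpow_mul_exp_neg hν

lemma besselInt_le_Gamma {ν : ℝ} (hν : 0 < ν) (z : ℝ) : besselInt ν z ≤ Real.Gamma ν := by
  rw [← integral_rpow_mul_exp_neg hν]
  refine setIntegral_mono_on (integrableOn_besselInt_of_pos hν z)
    (integrableOn_rpow_mul_exp_neg hν) measurableSet_Ioi fun g (hg : 0 < g) => ?_
  have : 0 ≤ z ^ 2 / (4 * g) := by positivity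
  gcongr
  linarith

lemma besselInt_abs (ν z : ℝ) : besselInt ν |z| = besselInt ν z := by
  simp [besselInt]

lemma besselInt_neg (ν z : ℝ) : besselInt ν (-z) = besselInt ν z := by
  simp [besselInt]

lemma continuous_besselInt {ν : ℝ} (hν : 0 < ν) : Continuous (besselInt ν) := by
  refine continuous_of_dominated (bound := fun g : ℝ => g ^ (ν - 1) * Real.exp (-g))
    (fun z => aestronglyMeasurable_besselInt_integrand ν z _) (fun z => ?_)
    (integrableOn_rpow_mul_exp_neg hν) (ae_of_all _ fun g => by fun_prop)
  filter_upwards [ae_restrict_mem measurableSet_Ioi] with g (hg : 0 < g)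
  rw [Real.norm_of_nonneg (by positivity)]
  have : 0 ≤ z ^ 2 / (4 * g) := by positivity
  gcongr
  linarith

/-- The integral representation of the modified Bessel function of the second kind. -/
lemma besselInt_eq_besselK (ν : ℝ) {z : ℝ} (hz : 0 < z) :
    besselInt ν z = 2 * (z / 2) ^ ν * besselK ν z := by
  set F : ℝ → ℝ := fun t => Real.exp (-z * Real.cosh t) * Real.exp (ν * t) with hF
  have hderiv : ∀ t ∈ (univ : Set ℝ), HasDerivWithinAt (fun t => z / 2 * Real.exp t)
      (z / 2 * Real.exp t) univ t := fun t _ =>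
    ((Real.hasDerivAt_exp t).const_mul _).hasDerivWithinAt
  have hinj : InjOn (fun t => z / 2 * Real.exp t) univ := fun a _ b _ h =>
    Real.exp_injective (mul_left_cancel₀ (by positivity) h)
  have himg : (fun t => z / 2 * Real.exp t) '' univ = Ioi 0 := by
    ext x
    simp only [image_univ, mem_range, mem_Ioi]
    constructor
    · rintro ⟨t, rfl⟩; positivity
    · intro hx
      refine ⟨Real.log (x / (z / 2)), ?_⟩
      rw [Real.exp_log (by positivity)]
      field_simp
  -- Under `g = (z/2) e^t` the exponent `-g - z²/(4g)` becomes `-z cosh t`.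
  have hval : ∀ t : ℝ, |z / 2 * Real.exp t| • ((z / 2 * Real.exp t) ^ (ν - 1) *
      Real.exp (-(z / 2 * Real.exp t) - z ^ 2 / (4 * (z / 2 * Real.exp t)))) =
      (z / 2) ^ ν * F t := by
    intro t
    have h0 : 0 < z / 2 * Real.exp t := by positivity
    have e1 : -(z / 2 * Real.exp t) - z ^ 2 / (4 * (z / 2 * Real.exp t)) =
        -z * Real.cosh t := by
      rw [Real.cosh_eq, Real.exp_neg]; field_simp
      ring
    rw [abs_of_pos h0, smul_eq_mul, e1, Real.rpow_sub_one h0.ne', Real.mul_rpow (by positivity)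
      (Real.exp_pos t).le, ← Real.exp_mul, hF, mul_comm t]
    field_simp
  have hFint : Integrable F := by
    have h := integrableOn_besselInt ν hz.ne'
    rw [← himg, integrableOn_image_iff_integrableOn_abs_deriv_smul MeasurableSet.univ hderiv hinj,
      integrableOn_univ] at h
    simp_rw [hval] at h
    have := h.const_mul ((z / 2) ^ ν)⁻¹
    simp_rw [← mul_assoc] at this
    simpa [inv_mul_cancel₀ (Real.rpow_pos_of_pos (half_pos hz) ν).ne'] using this
  have h1 : besselInt ν z = (z / 2) ^ ν * ∫ t, F t := by
    rw [besselInt, ← himg, integral_image_eq_integral_abs_deriv_smul MeasurableSet.univ hderiv hinj,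
      setIntegral_univ]
    simp_rw [hval]
    rw [integral_const_mul]
  -- Folding the negative half-line onto the positive one turns `exp (ν t)` into `2 cosh (ν t)`.
  have h2 : ∫ t, F t = 2 * besselK ν z := by
    rw [← integral_add_compl (measurableSet_Ioi (a := (0 : ℝ))) hFint, compl_Ioi,
      ← neg_zero, ← integral_comp_neg_Ioi, neg_zero, ← integral_add hFint.integrableOn
        hFint.comp_neg.integrableOn, besselK, ← integral_const_mul]
    congr 1
    ext t
    simp only [hF, Real.cosh_neg, mul_neg]
    rw [Real.cosh_eq (ν * t)]
    ring
  rw [h1, h2]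
  ring

lemma besselK_neg (ν z : ℝ) : besselK (-ν) z = besselK ν z := by
  simp [besselK]

lemma besselInt_neg_order (ν : ℝ) {z : ℝ} (hz : 0 < z) :
    besselInt (-ν) z = (z / 2) ^ (-(2 * ν)) * besselInt ν z := by
  rw [besselInt_eq_besselK _ hz, besselInt_eq_besselK _ hz, besselK_neg,
    show -ν = -(2 * ν) + ν by ring, Real.rpow_add (by positivity)]
  ring_nf

lemma hasDerivAt_besselInt (ν : ℝ) {z : ℝ} (hz : 0 < z) :
    HasDerivAt (besselInt ν) (-(z / 2) * besselInt (ν - 1) z) z := by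
  have key := hasDerivAt_integral_of_dominated_loc_of_deriv_le
    (μ := volume.restrict (Ioi (0 : ℝ))) (s := Ioo (z / 2) (2 * z)) (x₀ := z)
    (F := fun z g => g ^ (ν - 1) * Real.exp (-g - z ^ 2 / (4 * g)))
    (F' := fun z g => -(z / 2) * (g ^ (ν - 1 - 1) * Real.exp (-g - z ^ 2 / (4 * g))))
    -- On `(z/2, 2z)` the prefactor `x/2` is at most `z`, and the exponential is largest at the left
    -- end.
    (bound := fun g => z * (g ^ (ν - 1 - 1) * Real.exp (-g - (z / 2) ^ 2 / (4 * g))))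
    (Ioo_mem_nhds (by linarith) (by linarith))
    (Eventually.of_forall fun x => aestronglyMeasurable_besselInt_integrand ν x _)
    (integrableOn_besselInt ν hz.ne')
    ((aestronglyMeasurable_besselInt_integrand (ν - 1) z _).const_mul _) ?_
    ((integrableOn_besselInt (ν - 1) (by positivity)).const_mul _) ?_
  · have := key.2
    rwa [integral_const_mul] at this
  · filter_upwards [ae_restrict_mem measurableSet_Ioi] with g (hg : 0 < g) x hx
    have hx0 : 0 < x := by linarith [hx.1]
    rw [norm_mul, norm_neg, Real.norm_of_nonneg (by positivity),
      Real.norm_of_nonneg (by positivity)]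
    have := hx.1.le
    have := hx.2.le
    gcongr
    linarith
  · filter_upwards [ae_restrict_mem measurableSet_Ioi] with g (hg : 0 < g) x hx
    have : HasDerivAt (fun x : ℝ => -g - x ^ 2 / (4 * g)) (-(2 * x / (4 * g))) x := by
      simpa using ((hasDerivAt_pow 2 x).div_const (4 * g)).const_sub (-g)
    refine (this.exp.const_mul (g ^ (ν - 1))).congr_deriv ?_
    rw [Real.rpow_sub_one hg.ne' (ν - 1)]
    field_simp
    norm_num

/-- Follows from `x exp (-x) ≤ 1` at `x = z²/(4g)`. It controls the order `ν - 1`, possibly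
nonpositive, as `z → 0`. -/
lemma sq_mul_besselInt_le {ν : ℝ} (hν : 0 < ν) {z : ℝ} (hz : 0 < z) :
    (z / 2) ^ 2 * besselInt (ν - 1) z ≤ Real.Gamma ν := by
  rw [← integral_rpow_mul_exp_neg hν, besselInt, ← integral_const_mul]
  refine setIntegral_mono_on ((integrableOn_besselInt _ hz.ne').const_mul _)
    (integrableOn_rpow_mul_exp_neg hν) measurableSet_Ioi fun g (hg : 0 < g) => ?_
  have hx : z ^ 2 / (4 * g) * Real.exp (-(z ^ 2 / (4 * g))) ≤ 1 := by
    rw [Real.exp_neg, ← div_eq_mul_inv, div_le_one (Real.exp_pos _)]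
    linarith [Real.add_one_le_exp (z ^ 2 / (4 * g))]
  calc (z / 2) ^ 2 * (g ^ (ν - 1 - 1) * Real.exp (-g - z ^ 2 / (4 * g)))
      = g ^ (ν - 1) * Real.exp (-g) * (z ^ 2 / (4 * g) * Real.exp (-(z ^ 2 / (4 * g)))) := by
        rw [Real.rpow_sub_one hg.ne' (ν - 1), sub_eq_add_neg (-g), Real.exp_add]
        field_simp
        norm_num
    _ ≤ g ^ (ν - 1) * Real.exp (-g) * 1 := by gcongr
    _ = _ := mul_one _

/-! ### Struve-type series and the primitive of the Bessel density. -/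

/-- The series `∑ (z/2)^(2n) / (Γ(n + a) Γ(n + b))`. -/
noncomputable def gammaSeries (a b z : ℝ) : ℝ :=
  ∑' n : ℕ, (z / 2) ^ (2 * n) / (Real.Gamma (n + a) * Real.Gamma (n + b))

lemma summable_gammaSeries {a b : ℝ} (ha : 0 < a) (hb : 0 < b) (z : ℝ) :
    Summable fun n : ℕ => (z / 2) ^ (2 * n) / (Real.Gamma (n + a) * Real.Gamma (n + b)) := by
  rcases eq_or_ne z 0 with rfl | hz
  · refine summable_of_ne_finset_zero (s := {0}) fun n hn => ?_
    have : n ≠ 0 := by simpa using hn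
    simp [this]
  have hG : ∀ {c : ℝ}, 0 < c → ∀ n : ℕ, 0 < Real.Gamma (n + c) := fun hc n =>
    Real.Gamma_pos_of_pos (by positivity)
  have hz' : z / 2 ≠ 0 := by positivity
  refine summable_of_ratio_test_tendsto_lt_one zero_lt_one (Eventually.of_forall fun n =>
    div_ne_zero (pow_ne_zero _ hz') (mul_pos (hG ha n) (hG hb n)).ne') ?_
  have hrat : ∀ n : ℕ, ‖(z / 2) ^ (2 * (n + 1)) / (Real.Gamma ((n + 1 : ℕ) + a) *
      Real.Gamma ((n + 1 : ℕ) + b))‖ / ‖(z / 2) ^ (2 * n) / (Real.Gamma (n + a) *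
      Real.Gamma (n + b))‖ = (z / 2) ^ 2 * ((n + a)⁻¹ * (n + b)⁻¹) := by
    intro n
    have e : ∀ c : ℝ, 0 < c → Real.Gamma ((n + 1 : ℕ) + c) = (n + c) * Real.Gamma (n + c) := by
      intro c hc
      rw [← Real.Gamma_add_one (by positivity)]
      push_cast; ring_nf
    have h1 := hG ha n
    have h2 := hG hb n
    have h3 : 0 < ((z / 2) ^ 2) ^ n := by positivity
    rw [e a ha, e b hb, ← norm_div, pow_mul, pow_mul, pow_succ, Real.norm_of_nonneg (by positivity)]
    generalize (z / 2) ^ 2 = y at *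
    field_simp
  simp_rw [hrat]
  have hinv : ∀ c : ℝ, Tendsto (fun n : ℕ => ((n : ℝ) + c)⁻¹) atTop (𝓝 0) := fun c =>
    tendsto_inv_atTop_zero.comp (tendsto_atTop_add_const_right _ _ tendsto_natCast_atTop_atTop)
  simpa using ((hinv a).mul (hinv b)).const_mul ((z / 2) ^ 2)

lemma gammaSeries_nonneg {a b : ℝ} (ha : 0 < a) (hb : 0 < b) (z : ℝ) : 0 ≤ gammaSeries a b z :=
  tsum_nonneg fun n => by
    have := Real.Gamma_pos_of_pos (show 0 < n + a by positivity)
    have := Real.Gamma_pos_of_pos (show 0 < n + b by positivity)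
    rw [pow_mul]
    positivity

lemma gammaSeries_mono {a b : ℝ} (ha : 0 < a) (hb : 0 < b) {z w : ℝ} (hz : 0 ≤ z) (h : z ≤ w) :
    gammaSeries a b z ≤ gammaSeries a b w :=
  (summable_gammaSeries ha hb z).tsum_le_tsum (fun n => by
    have := Real.Gamma_pos_of_pos (show 0 < n + a by positivity)
    have := Real.Gamma_pos_of_pos (show 0 < n + b by positivity)
    gcongr) (summable_gammaSeries ha hb w)

/-- The split-off term `n = 0` is the only one that survives when the Bessel–Struve primitive is
differentiated. -/
lemma gammaSeries_half {b : ℝ} (hb : 0 < b) (z : ℝ) :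
    gammaSeries (1 / 2) b z =
      1 / (√Real.pi * Real.Gamma b) + (z / 2) ^ 2 * gammaSeries (3 / 2) (b + 1) z := by
  rw [gammaSeries, (summable_gammaSeries one_half_pos hb z).tsum_eq_zero_add, gammaSeries,
    ← tsum_mul_left]
  congr 1
  · simp only [mul_zero, pow_zero, Nat.cast_zero, zero_add, Real.Gamma_one_half_eq]
  · refine tsum_congr fun n => ?_
    rw [mul_add, pow_add]
    push_cast
    ring_nf

/-- The prefactor gives the `n`-th term the exponent `2(n + a)`, so differentiation produces the
factor `n + a` that lowers `Γ(n + a + 1)` to `Γ(n + a)`. The condition `1/2 ≤ a` makes `(y/2)^(2a -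
1)` increasing, which bounds the derivatives on `(0, 2z)`. -/
lemma hasDerivAt_rpow_mul_gammaSeries {a b : ℝ} (ha : 1 / 2 ≤ a) (hb : 0 < b) {z : ℝ}
    (hz : 0 < z) :
    HasDerivAt (fun z => (z / 2) ^ (2 * a) * gammaSeries (a + 1) b z)
      ((z / 2) ^ (2 * a - 1) * gammaSeries a b z) z := by
  have ha0 : 0 < a := by linarith
  have hG : ∀ {c : ℝ}, 0 < c → ∀ n : ℕ, 0 < Real.Gamma (n + c) := fun hc n =>
    Real.Gamma_pos_of_pos (by positivity)
  have key := hasDerivAt_tsum_of_isPreconnected (𝕜 := ℝ) (F := ℝ)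
    (g := fun (n : ℕ) z => (z / 2) ^ (2 * a) * ((z / 2) ^ (2 * n) / (Real.Gamma (n + (a + 1)) *
      Real.Gamma (n + b))))
    (g' := fun (n : ℕ) z => (z / 2) ^ (2 * a - 1) * ((z / 2) ^ (2 * n) / (Real.Gamma (n + a) *
      Real.Gamma (n + b))))
    (u := fun n : ℕ => z ^ (2 * a - 1) * ((2 * z / 2) ^ (2 * n) / (Real.Gamma (n + a) *
      Real.Gamma (n + b)))) (t := Ioo 0 (2 * z)) (y₀ := z) (y := z)
    ((summable_gammaSeries ha0 hb _).mul_left _) isOpen_Ioo isPreconnected_Ioo ?_ ?_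
    ⟨hz, by linarith⟩ ((summable_gammaSeries (by linarith) hb _).mul_left _) ⟨hz, by linarith⟩
  · simp only [tsum_mul_left] at key
    exact key
  · intro n y hy
    have hy0 : 0 < y / 2 := half_pos hy.1
    have e : Real.Gamma (n + (a + 1)) = (n + a) * Real.Gamma (n + a) := by
      rw [← add_assoc, Real.Gamma_add_one (by positivity)]
    have h1 : HasDerivAt (fun y : ℝ => (y / 2) ^ (2 * a + (2 * n : ℕ)))
        ((1 / 2) * (2 * a + (2 * n : ℕ)) * (y / 2) ^ (2 * a + (2 * n : ℕ) - 1)) y := by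
      simpa using ((hasDerivAt_id y).div_const 2).rpow_const (p := 2 * a + (2 * n : ℕ))
        (Or.inl hy0.ne')
    have h2 := h1.div_const (Real.Gamma (n + (a + 1)) * Real.Gamma (n + b))
    refine (h2.congr_of_eventuallyEq ?_).congr_deriv ?_
    · filter_upwards [lt_mem_nhds hy.1] with x hx
      rw [Real.rpow_add_natCast (half_pos hx).ne', mul_div_assoc]
    · have := hG ha0 n
      have := hG hb n
      have : 0 < n + a := by positivity
      rw [show 2 * a + (2 * n : ℕ) - 1 = 2 * a - 1 + (2 * n : ℕ) by ring,
        Real.rpow_add_natCast hy0.ne', e]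
      push_cast
      field_simp
      ring
  · intro n y hy
    have hy0 : 0 < y := hy.1
    have := hG ha0 n
    have := hG hb n
    rw [Real.norm_of_nonneg (by positivity)]
    have h1 : (y / 2) ^ (2 * a - 1) ≤ z ^ (2 * a - 1) :=
      Real.rpow_le_rpow (by positivity) (by linarith [hy.2]) (by linarith)
    have := hy.2.le
    gcongr

lemma struveL_eq_gammaSeries (μ z : ℝ) :
    struveL μ z = (z / 2) ^ (μ + 1) * gammaSeries (3 / 2) (μ + 3 / 2) z := by
  simp only [struveL, gammaSeries, add_assoc]

/-- The primitive of the Bessel-type density in terms of Bessel and Struve functions. -/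
lemma integral_besselInt {ν : ℝ} (hν : 1 / 2 ≤ ν) {w : ℝ} (hw : 0 < w) :
    ∫ u in (0 : ℝ)..w, besselInt ν u / (2 * √Real.pi * Real.Gamma (ν + 1 / 2)) =
      w / 2 * (besselK ν w * struveL (ν - 1) w + besselK (ν - 1) w * struveL ν w) := by
  have hν0 : 0 < ν := by linarith
  set A : ℝ → ℝ := fun z => (z / 2) ^ (2 * (1 / 2 : ℝ)) * gammaSeries (1 / 2 + 1) (ν + 1 / 2) z
  set B : ℝ → ℝ := fun z => (z / 2) ^ (2 * (ν + 1 / 2)) * gammaSeries (ν + 1 / 2 + 1) (3 / 2) z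
  -- `T` is the claimed primitive, rewritten so that both Bessel factors and both series have simple
  -- derivatives. The order `1 - ν` is used because its derivative involves `-ν`, which reflects to
  -- `ν`.
  set T : ℝ → ℝ := fun z => 1 / 2 * (besselInt ν z * A z + besselInt (1 - ν) z * B z) with hT
  have hcomm : ∀ a b z, gammaSeries a b z = gammaSeries b a z := fun a b z => by
    simp only [gammaSeries, mul_comm]
  have hA : ∀ z, A z = z / 2 * gammaSeries (3 / 2) (ν + 1 / 2) z := fun z => by
    simp only [A]; norm_num
  have hB : ∀ z, B z = (z / 2) ^ (2 * ν + 1) * gammaSeries (3 / 2) (ν + 3 / 2) z := fun z => by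
    simp only [B]
    rw [hcomm, show ν + 1 / 2 + 1 = ν + 3 / 2 by ring, show 2 * (ν + 1 / 2) = 2 * ν + 1 by ring]
  have hrefl : ∀ z, 0 < z → besselInt (1 - ν) z = (z / 2) ^ (2 - 2 * ν) * besselInt (ν - 1) z := by
    intro z hz
    rw [show 1 - ν = -(ν - 1) by ring, besselInt_neg_order _ hz]
    ring_nf
  have hTK : ∀ z, 0 < z → T z =
      z / 2 * (besselK ν z * struveL (ν - 1) z + besselK (ν - 1) z * struveL ν z) := by
    intro z hz
    have hq : 0 < z / 2 := half_pos hz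
    simp only [hT]
    rw [hrefl z hz, hA, hB, struveL_eq_gammaSeries, struveL_eq_gammaSeries,
      besselInt_eq_besselK _ hz, besselInt_eq_besselK _ hz, sub_add_cancel,
      show ν - 1 + 3 / 2 = ν + 1 / 2 by ring]
    have e1 : (z / 2) ^ (2 - 2 * ν) * (z / 2) ^ (ν - 1) * (z / 2) ^ (2 * ν + 1) =
        z / 2 * (z / 2) ^ (ν + 1) := by
      rw [← Real.rpow_add hq, ← Real.rpow_add hq, ← Real.rpow_one_add' hq.le (by linarith)]
      ring_nf
    linear_combination (gammaSeries (3 / 2) (ν + 3 / 2) z) * besselK (ν - 1) z * e1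
  have hTderiv : ∀ z, 0 < z →
      HasDerivAt T (besselInt ν z / (2 * √Real.pi * Real.Gamma (ν + 1 / 2))) z := by
    intro z hz
    have hq : 0 < z / 2 := half_pos hz
    have dA := hasDerivAt_rpow_mul_gammaSeries (a := 1 / 2) (b := ν + 1 / 2) le_rfl
      (by linarith) hz
    have dB := hasDerivAt_rpow_mul_gammaSeries (a := ν + 1 / 2) (b := 3 / 2) (by linarith)
      (by norm_num) hz
    refine ((((hasDerivAt_besselInt ν hz).mul dA).add
      ((hasDerivAt_besselInt (1 - ν) hz).mul dB)).const_mul (1 / 2)).congr_deriv ?_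
    have hAz := hA z
    have hBz := hB z
    simp only [A, B] at hAz hBz
    rw [hAz, hBz, gammaSeries_half (by linarith), hcomm (ν + 1 / 2) (3 / 2),
      show 1 - ν - 1 = -ν by ring, besselInt_neg_order _ hz, hrefl z hz,
      show ν + 1 / 2 + 1 = ν + 3 / 2 by ring, show 2 * (1 / 2 : ℝ) - 1 = 0 by norm_num,
      Real.rpow_zero, show 2 * (ν + 1 / 2) - 1 = 2 * ν by ring]
    have e1 : (z / 2) ^ (-(2 * ν)) * (z / 2) ^ (2 * ν + 1) = z / 2 := by
      rw [← Real.rpow_add hq]; simp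
    have e2 : (z / 2) ^ (2 - 2 * ν) * (z / 2) ^ (2 * ν) = (z / 2) ^ 2 := by
      rw [← Real.rpow_add hq]; simp
    have hGp : Real.Gamma (ν + 1 / 2) ≠ 0 := (Real.Gamma_pos_of_pos (by linarith)).ne'
    have hπ : √Real.pi ≠ 0 := by positivity
    have e3 : besselInt ν z / (2 * √Real.pi * Real.Gamma (ν + 1 / 2)) =
        1 / 2 * (besselInt ν z * (1 / (√Real.pi * Real.Gamma (ν + 1 / 2)))) := by field_simp
    rw [e3]
    -- The product-rule terms cancel in pairs, up to the leading term from `gammaSeries_half`.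
    linear_combination (-(1 / 2) * (z / 2) * besselInt ν z * gammaSeries (3 / 2) (ν + 3 / 2) z) * e1
      + (1 / 2 * besselInt (ν - 1) z * gammaSeries (3 / 2) (ν + 1 / 2) z) * e2
  -- For `z < 1` both series are bounded by their values at `1`, and both Bessel factors, after
  -- absorbing `(z/2)²` in the second, by `Γ(ν)`; this leaves a bound linear in `z`.
  have hT0 : Tendsto T (𝓝[>] 0) (𝓝 0) := by
    have hup : Tendsto (fun z : ℝ => z * (Real.Gamma ν * (gammaSeries (3 / 2) (ν + 1 / 2) 1 +
        gammaSeries (3 / 2) (ν + 3 / 2) 1))) (𝓝[>] 0) (𝓝 0) := by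
      have : Continuous (fun z : ℝ => z * (Real.Gamma ν * (gammaSeries (3 / 2) (ν + 1 / 2) 1 +
        gammaSeries (3 / 2) (ν + 3 / 2) 1))) := by fun_prop
      simpa using (this.tendsto 0).mono_left nhdsWithin_le_nhds
    refine tendsto_of_tendsto_of_tendsto_of_le_of_le' tendsto_const_nhds hup ?_ ?_
    · filter_upwards [self_mem_nhdsWithin] with z (hz : 0 < z)
      have h1 := gammaSeries_nonneg (a := 3 / 2) (b := ν + 1 / 2) (by norm_num) (by linarith) z
      have h2 := gammaSeries_nonneg (a := 3 / 2) (b := ν + 3 / 2) (by norm_num) (by linarith) z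
      have := besselInt_nonneg ν z
      have := besselInt_nonneg (1 - ν) z
      simp only [hT, hA, hB]
      positivity
    · filter_upwards [Ioo_mem_nhdsGT (zero_lt_one (α := ℝ))] with z hz
      have hz0 : 0 < z := hz.1
      have hq : 0 < z / 2 := half_pos hz0
      have h1 := gammaSeries_nonneg (a := 3 / 2) (b := ν + 1 / 2) (by norm_num) (by linarith) z
      have h2 := gammaSeries_nonneg (a := 3 / 2) (b := ν + 3 / 2) (by norm_num) (by linarith) z
      have h3 := gammaSeries_mono (a := 3 / 2) (b := ν + 1 / 2) (by norm_num) (by linarith)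
        hz0.le hz.2.le
      have h4 := gammaSeries_mono (a := 3 / 2) (b := ν + 3 / 2) (by norm_num) (by linarith)
        hz0.le hz.2.le
      have h5 := besselInt_le_Gamma hν0 z
      have h6 := sq_mul_besselInt_le hν0 hz0
      have h7 := besselInt_nonneg ν z
      have h8 := besselInt_nonneg (ν - 1) z
      have hΓ := (Real.Gamma_pos_of_pos hν0).le
      simp only [hT, hA, hB]
      rw [hrefl z hz0]
      have e : (z / 2) ^ (2 - 2 * ν) * (z / 2) ^ (2 * ν + 1) = (z / 2) ^ 2 * (z / 2) := by
        rw [← Real.rpow_add hq, ← pow_succ, ← Real.rpow_natCast]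
        push_cast
        ring_nf
      calc 1 / 2 * (besselInt ν z * (z / 2 * gammaSeries (3 / 2) (ν + 1 / 2) z) +
            (z / 2) ^ (2 - 2 * ν) * besselInt (ν - 1) z *
              ((z / 2) ^ (2 * ν + 1) * gammaSeries (3 / 2) (ν + 3 / 2) z))
          = 1 / 4 * z * (besselInt ν z * gammaSeries (3 / 2) (ν + 1 / 2) z +
            ((z / 2) ^ 2 * besselInt (ν - 1) z) * gammaSeries (3 / 2) (ν + 3 / 2) z) := by
            linear_combination (1 / 2 * besselInt (ν - 1) z *
              gammaSeries (3 / 2) (ν + 3 / 2) z) * e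
        _ ≤ 1 * z * (Real.Gamma ν * gammaSeries (3 / 2) (ν + 1 / 2) 1 +
            Real.Gamma ν * gammaSeries (3 / 2) (ν + 3 / 2) 1) := by
            gcongr
            norm_num
        _ = _ := by ring
  have hint : IntervalIntegrable
      (fun u => besselInt ν u / (2 * √Real.pi * Real.Gamma (ν + 1 / 2))) volume 0 w :=
    ((continuous_besselInt hν0).div_const _).intervalIntegrable _ _
  rw [intervalIntegral.integral_eq_sub_of_hasDerivAt_of_tendsto hw (fun x hx => hTderiv x hx.1)
    hint hT0 ((hTderiv w hw).continuousAt.tendsto.mono_left nhdsWithin_le_nhds), sub_zero,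
    hTK w hw]

/-! ### The Bessel density and its characteristic function. -/

/-- The probability density whose characteristic function is `(1 + t²) ^ (-(ν + 1/2))`. -/
noncomputable def besselDensity (ν u : ℝ) : ℝ :=
  besselInt ν u / (2 * √Real.pi * Real.Gamma (ν + 1 / 2))

lemma besselDensity_nonneg {ν : ℝ} (hν : 0 < ν) (u : ℝ) : 0 ≤ besselDensity ν u := by
  have := besselInt_nonneg ν u
  have := Real.Gamma_pos_of_pos (show 0 < ν + 1 / 2 by linarith)
  unfold besselDensity
  positivity

lemma continuous_besselDensity {ν : ℝ} (hν : 0 < ν) : Continuous (besselDensity ν) :=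
  (continuous_besselInt hν).div_const _

lemma besselDensity_neg (ν u : ℝ) : besselDensity ν (-u) = besselDensity ν u := by
  simp only [besselDensity, besselInt_neg]

lemma besselDensity_abs (ν u : ℝ) : besselDensity ν |u| = besselDensity ν u := by
  simp only [besselDensity, besselInt_abs]

/-- Log-convexity of `Γ` gives `Γ(ν + 1) ≤ √(ν + 1/2) Γ(ν + 1/2)`, hence `Γ(ν) ≤ 2 Γ(ν + 1/2)` once
`ν ≥ 1/2`. Uniformity in `ν` lets the mixture weights alone serve as a summable majorant. -/
lemma besselDensity_le_one {ν : ℝ} (hν : 1 / 2 ≤ ν) (u : ℝ) : besselDensity ν u ≤ 1 := by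
  have hν0 : 0 < ν := by linarith
  have h1 := Real.Gamma_pos_of_pos (show 0 < ν + 1 / 2 by linarith)
  have h2 := Real.Gamma_mul_add_mul_le_rpow_Gamma_mul_rpow_Gamma (s := ν + 1 / 2)
    (t := ν + 1 / 2 + 1) (a := 1 / 2) (b := 1 / 2) (by linarith) (by linarith) (by norm_num)
    (by norm_num) (by norm_num)
  rw [Real.Gamma_add_one (by linarith), Real.mul_rpow (by linarith) h1.le,
    show 1 / 2 * (ν + 1 / 2) + 1 / 2 * (ν + 1 / 2 + 1) = ν + 1 by ring,
    Real.Gamma_add_one hν0.ne', mul_left_comm, ← Real.rpow_add h1, add_halves, Real.rpow_one] at h2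
  have h3 : (ν + 1 / 2) ^ (1 / 2 : ℝ) ≤ ν + 1 / 2 := by
    simpa using Real.rpow_le_rpow_of_exponent_le (x := ν + 1 / 2) (y := 1 / 2) (z := 1)
      (by linarith) (by norm_num)
  have h4 : Real.Gamma ν ≤ 2 * Real.Gamma (ν + 1 / 2) := by
    refine le_of_mul_le_mul_left ?_ hν0
    calc ν * Real.Gamma ν ≤ _ := h2
      _ ≤ (ν + 1 / 2) * Real.Gamma (ν + 1 / 2) := by gcongr
      _ ≤ (2 * ν) * Real.Gamma (ν + 1 / 2) := by gcongr; linarith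
      _ = _ := by ring
  have hπ : 1 ≤ √Real.pi := Real.one_le_sqrt.2 (by linarith [Real.pi_gt_three])
  rw [besselDensity, div_le_one (by positivity)]
  calc besselInt ν u ≤ Real.Gamma ν := besselInt_le_Gamma hν0 u
    _ ≤ 2 * 1 * Real.Gamma (ν + 1 / 2) := by linarith
    _ ≤ _ := by gcongr

lemma besselDensity_eq_besselK (ν : ℝ) {u : ℝ} (hu : 0 < u) :
    besselDensity ν u =
      1 / √Real.pi * (besselK ν u / Real.Gamma (ν + 1 / 2) * (u / 2) ^ ν) := by
  rw [besselDensity, besselInt_eq_besselK ν hu]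
  field_simp

lemma besselDensity_zero {ν : ℝ} (hν : 0 < ν) :
    besselDensity ν 0 = 1 / √Real.pi * (Real.Gamma ν / (2 * Real.Gamma (ν + 1 / 2))) := by
  rw [besselDensity, besselInt_zero hν]
  field_simp

lemma integral_cexp_mul_gaussian {g : ℝ} (hg : 0 < g) (t : ℝ) :
    ∫ u : ℝ, Complex.exp (t * u * Complex.I) * (Real.exp (-(u ^ 2 / (4 * g))) : ℂ) =
      (2 * √Real.pi * g ^ (1 / 2 : ℝ) * Real.exp (-(t ^ 2 * g)) : ℝ) := by
  have h := fourierIntegral_gaussian (b := ((1 / (4 * g) : ℝ) : ℂ))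
    (by rw [Complex.ofReal_re]; positivity) t
  have e1 : (Real.pi / ((1 / (4 * g) : ℝ) : ℂ)) ^ (1 / 2 : ℂ) =
      ((2 * √Real.pi * g ^ (1 / 2 : ℝ) : ℝ) : ℂ) := by
    rw [← Complex.ofReal_div, show (1 / 2 : ℂ) = ((1 / 2 : ℝ) : ℂ) by push_cast; rfl,
      ← Complex.ofReal_cpow (by positivity)]
    congr 1
    rw [show Real.pi / (1 / (4 * g)) = 2 ^ 2 * Real.pi * g by field_simp; norm_num,
      Real.mul_rpow (by positivity) hg.le, ← Real.sqrt_eq_rpow (2 ^ 2 * Real.pi),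
      Real.sqrt_mul (by positivity), Real.sqrt_sq (by norm_num)]
  rw [e1] at h
  rw [Complex.ofReal_mul, Complex.ofReal_exp]
  convert h using 2
  · ext u
    congr 2
    · ring_nf
    · push_cast
      ring_nf
  · push_cast
    have : (g : ℂ) ≠ 0 := by exact_mod_cast hg.ne'
    field_simp

lemma integrable_gaussian_div {g : ℝ} (hg : 0 < g) :
    Integrable fun u : ℝ => Real.exp (-(u ^ 2 / (4 * g))) := by
  refine (integrable_exp_neg_mul_sq (b := 1 / (4 * g)) (by positivity)).congr
    (ae_of_all _ fun u => ?_)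
  simp only
  congr 1
  ring

lemma integral_gaussian_div {g : ℝ} (hg : 0 < g) :
    ∫ u : ℝ, Real.exp (-(u ^ 2 / (4 * g))) = 2 * √Real.pi * g ^ (1 / 2 : ℝ) := by
  have h := integral_cexp_mul_gaussian hg 0
  simp only [Complex.ofReal_zero, zero_mul, Complex.exp_zero, one_mul, integral_complex_ofReal,
    Complex.ofReal_inj] at h
  simpa using h

/-- The integrand of the characteristic function of `besselDensity`, as a function on the
product space. -/
noncomputable def besselKernel (ν t : ℝ) (x : ℝ × ℝ) : ℂ :=
  (x.1 ^ (ν - 1) * Real.exp (-x.1) : ℝ) *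
    (Complex.exp (t * x.2 * Complex.I) * (Real.exp (-(x.2 ^ 2 / (4 * x.1))) : ℂ))

/-- This licenses Fubini. Integrating the norm over `u` contributes `g^(1/2)`, which leaves a Gamma
integral of parameter `ν + 1/2`. -/
lemma integrable_besselKernel {ν : ℝ} (hν : 0 < ν) (t : ℝ) :
    Integrable (besselKernel ν t) ((volume.restrict (Ioi 0)).prod volume) := by
  have hm : AEStronglyMeasurable (besselKernel ν t) ((volume.restrict (Ioi 0)).prod volume) := by
    unfold besselKernel
    refine Measurable.aestronglyMeasurable (Measurable.mul ?_ (Measurable.mul ?_ ?_)) <;> fun_prop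
  have hnorm : ∀ g : ℝ, 0 < g → ∀ u : ℝ, ‖besselKernel ν t (g, u)‖ =
      g ^ (ν - 1) * Real.exp (-g) * Real.exp (-(u ^ 2 / (4 * g))) := by
    intro g hg u
    have : (t : ℂ) * u * Complex.I = ((t * u : ℝ) : ℂ) * Complex.I := by push_cast; rfl
    rw [besselKernel, norm_mul, norm_mul, this, Complex.norm_exp_ofReal_mul_I, one_mul,
      Complex.norm_of_nonneg (by positivity), Complex.norm_of_nonneg (by positivity)]
  rw [integrable_prod_iff hm]
  refine ⟨?_, ?_⟩
  · filter_upwards [ae_restrict_mem measurableSet_Ioi] with g (hg : 0 < g)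
    refine (((integrable_gaussian_div hg).const_mul (g ^ (ν - 1) * Real.exp (-g)))).mono'
      (by unfold besselKernel; exact Measurable.aestronglyMeasurable (by fun_prop))
      (ae_of_all _ fun u => (hnorm g hg u).le)
  · refine ((integrableOn_rpow_mul_exp_neg (ν := ν + 1 / 2) (by linarith)).const_mul
      (2 * √Real.pi)).congr ?_
    filter_upwards [ae_restrict_mem measurableSet_Ioi] with g (hg : 0 < g)
    simp_rw [hnorm g hg]
    rw [integral_const_mul, integral_gaussian_div hg, show ν + 1 / 2 - 1 = ν - 1 + 1 / 2 by ring,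
      Real.rpow_add hg]
    ring

lemma integral_besselKernel_fst (ν t u : ℝ) :
    ∫ g in Ioi (0 : ℝ), besselKernel ν t (g, u) =
      Complex.exp (t * u * Complex.I) * (besselInt ν u : ℂ) := by
  rw [besselInt, ← integral_complex_ofReal, ← integral_const_mul]
  refine integral_congr_ae (ae_of_all _ fun g => ?_)
  simp only [besselKernel]
  rw [sub_eq_add_neg (-g), Real.exp_add]
  push_cast
  ring

lemma integrable_besselInt {ν : ℝ} (hν : 0 < ν) : Integrable (besselInt ν) := by
  have h := (integrable_besselKernel hν 0).integral_prod_right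
  simp_rw [integral_besselKernel_fst ν] at h
  simpa using h.re

lemma integrable_besselDensity {ν : ℝ} (hν : 0 < ν) : Integrable (besselDensity ν) :=
  (integrable_besselInt hν).div_const _

/-- The characteristic function of `besselDensity`. -/
lemma integral_cexp_mul_besselDensity {ν : ℝ} (hν : 0 < ν) (t : ℝ) :
    ∫ u : ℝ, Complex.exp (t * u * Complex.I) * (besselDensity ν u : ℂ) =
      ((1 + t ^ 2) ^ (-(ν + 1 / 2)) : ℝ) := by
  have hΓ := Real.Gamma_pos_of_pos (show 0 < ν + 1 / 2 by linarith)
  have h1 : ∫ u : ℝ, Complex.exp (t * u * Complex.I) * (besselInt ν u : ℂ) =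
      (2 * √Real.pi * Real.Gamma (ν + 1 / 2) * (1 + t ^ 2) ^ (-(ν + 1 / 2)) : ℝ) := by
    -- After the swap the inner integral is a Gaussian Fourier transform, and the outer one is `∫
    -- g^(ν - 1/2) exp (-(1 + t²) g)`.
    simp_rw [← integral_besselKernel_fst ν]
    rw [← integral_integral_swap (f := fun g u => besselKernel ν t (g, u))
      (integrable_besselKernel hν t)]
    have h2 : ∫ g in Ioi (0 : ℝ), ∫ u : ℝ, besselKernel ν t (g, u) =
        ∫ g in Ioi (0 : ℝ), ((2 * √Real.pi * (g ^ (ν + 1 / 2 - 1) *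
          Real.exp (-((1 + t ^ 2) * g))) : ℝ) : ℂ) := by
      refine setIntegral_congr_fun measurableSet_Ioi fun g (hg : 0 < g) => ?_
      simp only [besselKernel]
      rw [integral_const_mul, integral_cexp_mul_gaussian hg, ← Complex.ofReal_mul,
        show ν + 1 / 2 - 1 = ν - 1 + 1 / 2 by ring, Real.rpow_add hg,
        show -((1 + t ^ 2) * g) = -g + -(t ^ 2 * g) by ring, Real.exp_add]
      congr 1
      ring
    rw [h2, integral_complex_ofReal, integral_const_mul,
      Real.integral_rpow_mul_exp_neg_mul_Ioi (by linarith) (by positivity),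
      Real.rpow_neg (by positivity), one_div, Real.inv_rpow (by positivity)]
    congr 1
    ring
  simp_rw [besselDensity, Complex.ofReal_div, mul_div_assoc']
  rw [integral_div, h1, ← Complex.ofReal_div]
  congr 1
  field_simp

lemma integral_besselDensity {ν : ℝ} (hν : 0 < ν) : ∫ u, besselDensity ν u = 1 := by
  have h := integral_cexp_mul_besselDensity hν 0
  simp only [Complex.ofReal_zero, zero_mul, Complex.exp_zero, one_mul, integral_complex_ofReal,
    Complex.ofReal_inj] at h
  simpa using h

/-! ### Binomial series and sums over multi-indices. -/

lemma multichoose_half (n : ℕ) : Ring.multichoose (1 / 2 : ℝ) n =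
    (((2 * n)! : ℕ) : ℝ) / ((n ! : ℝ) ^ 2 * 4 ^ n) := by
  have h := Ring.factorial_nsmul_multichoose_eq_ascPochhammer (1 / 2 : ℝ) n
  rw [nsmul_eq_mul] at h
  have h2 : ∀ n : ℕ, (n ! : ℝ) * 4 ^ n * (ascPochhammer ℕ n).smeval (1 / 2 : ℝ) =
      (((2 * n)! : ℕ) : ℝ) := by
    intro n
    rw [Polynomial.ascPochhammer_smeval_eq_eval]
    induction n with
    | zero => simp
    | succ n ih =>
      rw [ascPochhammer_succ_eval, show 2 * (n + 1) = 2 * n + 1 + 1 by ring, Nat.factorial_succ,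
        Nat.factorial_succ, Nat.factorial_succ]
      push_cast
      rw [← ih]
      ring
  have h3 : (n ! : ℝ) ≠ 0 := by positivity
  rw [eq_div_iff (by positivity), ← h2 n, ← h]
  ring

/-- The binomial series of `(1 - x) ^ (-1/2)`. -/
lemma hasSum_one_sub_rpow_neg_half {x : ℝ} (hx : |x| < 1) :
    HasSum (fun n : ℕ => (((2 * n)! : ℕ) : ℝ) / ((n ! : ℝ) ^ 2 * 4 ^ n) * x ^ n)
      ((1 - x) ^ (-(1 / 2) : ℝ)) := by
  have h := (Real.one_div_one_sub_rpow_hasFPowerSeriesOnBall_zero (1 / 2)).hasSum (y := x)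
    (by simpa [enorm_eq_nnnorm, ← NNReal.coe_lt_coe] using hx)
  rw [zero_add] at h
  have e : (1 : ℝ) / (1 - x) ^ (1 / 2 : ℝ) = (1 - x) ^ (-(1 / 2) : ℝ) := by
    rw [Real.rpow_neg (by linarith [(abs_lt.1 hx).2]), one_div]
  rw [e] at h
  have e2 : ∀ n : ℕ, (FormalMultilinearSeries.ofScalars ℝ
      (fun n : ℕ => Ring.choose ((1 / 2 : ℝ) + n - 1) n) n) (fun _ => x) =
      (((2 * n)! : ℕ) : ℝ) / ((n ! : ℝ) ^ 2 * 4 ^ n) * x ^ n := fun n => by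
    rw [FormalMultilinearSeries.ofScalars_apply_eq, ← Ring.multichoose_eq, multichoose_half,
      smul_eq_mul]
  simpa only [e2] using h

/-- Nonnegativity makes the double series summable at each step of the induction on the number of
factors. -/
lemma hasSum_fin_prod {n : ℕ} {f : Fin n → ℕ → ℝ} {a : Fin n → ℝ} (h0 : ∀ i k, 0 ≤ f i k)
    (h : ∀ i, HasSum (f i) (a i)) :
    HasSum (fun κ : Fin n → ℕ => ∏ i, f i (κ i)) (∏ i, a i) := by
  induction n with
  | zero => simp
  | succ n ih =>
    have h2 := ih (fun i => h0 i.succ) fun i => h i.succ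
    set g : (Fin n → ℕ) → ℝ := fun κ => ∏ i, f i.succ (κ i) with hg
    have hg0 : 0 ≤ g := fun κ => Finset.prod_nonneg fun i _ => h0 _ _
    have h3 := (h 0).mul h2 ((h 0).summable.mul_of_nonneg h2.summable (h0 0) hg0)
    rw [Fin.prod_univ_succ, ← (Fin.consEquiv fun _ : Fin (n + 1) => ℕ).hasSum_iff]
    have e : (fun κ : Fin (n + 1) → ℕ => ∏ i, f i (κ i)) ∘ (Fin.consEquiv fun _ => ℕ) =
        fun x : ℕ × (Fin n → ℕ) => f 0 x.1 * g x.2 := by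
      ext x
      simp [hg, Fin.prod_univ_succ, Fin.consEquiv]
    rw [e]
    exact h3

/-- Grouping a series over multi-indices by the sum of the indices. -/
lemma hasSum_antidiagonalTuple {n : ℕ} {f : (Fin n → ℕ) → ℝ} {a : ℝ} (h : HasSum f a) :
    HasSum (fun k => ∑ κ ∈ Finset.Nat.antidiagonalTuple n k, f κ) a := by
  have e := (Equiv.sigmaFiberEquiv fun κ : Fin n → ℕ => ∑ i, κ i).hasSum_iff.2 h
  refine e.sigma fun k => ?_
  have h2 := (Finset.Nat.antidiagonalTuple n k).hasSum f
  let e2 : {κ : Fin n → ℕ // ∑ i, κ i = k} ≃ {κ // κ ∈ Finset.Nat.antidiagonalTuple n k} :=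
    Equiv.subtypeEquivRight fun κ => Finset.Nat.mem_antidiagonalTuple.symm
  exact e2.hasSum_iff.2 h2

/-! ### The mixture weights. -/

section Weights

variable {r : ℕ} {ρ : ℕ → ℝ}

lemma one_sub_sq_div_sq_mem {a b : ℝ} (ha : 0 < a) (hab : a ≤ b) :
    0 ≤ 1 - a ^ 2 / b ^ 2 ∧ 1 - a ^ 2 / b ^ 2 < 1 := by
  have hb : 0 < b := ha.trans_le hab
  constructor
  · rw [sub_nonneg, div_le_one (by positivity)]
    gcongr
  · rw [sub_lt_self_iff]
    positivity

lemma multiCoeff_nonneg (hpos : 0 < ρ (r - 1)) (hle : ∀ i < r - 1, ρ (r - 1) ≤ ρ i)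
    (κ : Fin (r - 1) → ℕ) : 0 ≤ multiCoeff r ρ κ :=
  Finset.prod_nonneg fun i _ => by
    have h1 := hle i i.2
    have h2 := (one_sub_sq_div_sq_mem hpos h1).1
    have h3 : 0 < ρ i := hpos.trans_le h1
    positivity

/-- A product of binomial series. Taking `y = 1` yields the total mass of the weights, and `y = 1/(1
+ t²)` the characteristic function of the mixture. -/
lemma hasSum_multiCoeff_mul_pow (hpos : 0 < ρ (r - 1)) (hle : ∀ i < r - 1, ρ (r - 1) ≤ ρ i)
    {y : ℝ} (hy0 : 0 ≤ y) (hy1 : y ≤ 1) :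
    HasSum (fun κ : Fin (r - 1) → ℕ => multiCoeff r ρ κ * y ^ (∑ i, κ i))
      (∏ i : Fin (r - 1),
        (ρ (r - 1) / ρ i * (1 - (1 - ρ (r - 1) ^ 2 / ρ i ^ 2) * y) ^ (-(1 / 2) : ℝ))) := by
  have h := hasSum_fin_prod (n := r - 1)
    (f := fun i k => ρ (r - 1) / ρ i * ((((2 * k)! : ℕ) : ℝ) / ((k ! : ℝ) ^ 2 * 4 ^ k) *
      ((1 - ρ (r - 1) ^ 2 / ρ i ^ 2) * y) ^ k))
    (a := fun i => ρ (r - 1) / ρ i * (1 - (1 - ρ (r - 1) ^ 2 / ρ i ^ 2) * y) ^ (-(1 / 2) : ℝ))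
    (fun i k => ?_) fun i => ?_
  · convert h using 2 with κ
    rw [multiCoeff, ← Finset.prod_pow_eq_pow_sum, ← Finset.prod_mul_distrib]
    refine Finset.prod_congr rfl fun i _ => ?_
    rw [mul_pow]
    ring
  · have h1 := hle i i.2
    have h2 := (one_sub_sq_div_sq_mem hpos h1).1
    have h3 : 0 < ρ i := hpos.trans_le h1
    positivity
  · obtain ⟨h1, h2⟩ := one_sub_sq_div_sq_mem hpos (hle i i.2)
    refine (hasSum_one_sub_rpow_neg_half ?_).mul_left _
    rw [abs_of_nonneg (by positivity)]
    exact (mul_le_of_le_one_right h1 hy1).trans_lt h2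

lemma sq_rpow_neg_half {x : ℝ} (hx : 0 ≤ x) : (x ^ 2) ^ (-(1 / 2) : ℝ) = x⁻¹ := by
  rw [Real.rpow_neg (by positivity), ← Real.sqrt_eq_rpow, Real.sqrt_sq hx]

lemma hasSum_multiCoeff (hpos : 0 < ρ (r - 1)) (hle : ∀ i < r - 1, ρ (r - 1) ≤ ρ i) :
    HasSum (multiCoeff r ρ) 1 := by
  have h := hasSum_multiCoeff_mul_pow hpos hle zero_le_one le_rfl
  simp only [one_pow, mul_one, sub_sub_cancel] at h
  rwa [Finset.prod_eq_one] at h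
  intro i _
  have h3 : 0 < ρ i := hpos.trans_le (hle i i.2)
  rw [← div_pow, sq_rpow_neg_half (by positivity), mul_inv_cancel₀ (by positivity)]

/-- With `s = ρ (r - 1)`, it rests on `1 + (ρ_i/s)² t² = (ρ_i/s)² (1 + t²) (1 - (1 - s²/ρ_i²)/(1 +
t²))`. -/
lemma hasSum_multiCoeff_mul_rpow (hr : 1 ≤ r) (hpos : 0 < ρ (r - 1))
    (hle : ∀ i < r - 1, ρ (r - 1) ≤ ρ i) (t : ℝ) :
    HasSum (fun κ : Fin (r - 1) → ℕ => multiCoeff r ρ κ *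
        (1 + t ^ 2) ^ (-(((r : ℝ) - 1) / 2 + ∑ i, (κ i : ℝ) + 1 / 2)))
      (∏ i ∈ Finset.range r, (1 + (ρ i / ρ (r - 1)) ^ 2 * t ^ 2) ^ (-(1 / 2) : ℝ)) := by
  have ht : 0 < 1 + t ^ 2 := by positivity
  have h := (hasSum_multiCoeff_mul_pow hpos hle (y := (1 + t ^ 2)⁻¹) (by positivity)
    (inv_le_one_of_one_le₀ (by nlinarith))).mul_left ((1 + t ^ 2) ^ (-(r / 2 : ℝ)))
  have e1 : ∀ κ : Fin (r - 1) → ℕ, (1 + t ^ 2) ^ (-(r / 2 : ℝ)) *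
      (multiCoeff r ρ κ * (1 + t ^ 2)⁻¹ ^ (∑ i, κ i)) = multiCoeff r ρ κ *
        (1 + t ^ 2) ^ (-(((r : ℝ) - 1) / 2 + ∑ i, (κ i : ℝ) + 1 / 2)) := by
    intro κ
    rw [show -(((r : ℝ) - 1) / 2 + ∑ i, (κ i : ℝ) + 1 / 2) =
      -(r / 2 : ℝ) + -((∑ i, κ i : ℕ) : ℝ) by push_cast; ring, Real.rpow_add ht,
      Real.rpow_neg ht.le ((∑ i, κ i : ℕ) : ℝ), Real.rpow_natCast, inv_pow]
    ring
  simp_rw [e1] at h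
  refine Eq.subst (motive := fun a => HasSum _ a) (Eq.symm ?_) h
  -- One factor goes to each of the `r - 1` expanded terms; the last is the term `i = r - 1`, whose
  -- ratio is `1`.
  have e2 : (1 + t ^ 2) ^ (-(r / 2 : ℝ)) =
      (∏ _i : Fin (r - 1), (1 + t ^ 2) ^ (-(1 / 2) : ℝ)) * (1 + t ^ 2) ^ (-(1 / 2) : ℝ) := by
    rw [Finset.prod_const, Finset.card_univ, Fintype.card_fin, ← pow_succ, Nat.sub_add_cancel hr,
      ← Real.rpow_mul_natCast ht.le]
    ring_nf
  rw [e2, mul_right_comm, ← Finset.prod_mul_distrib]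
  conv_lhs => rw [← Nat.sub_add_cancel hr, Finset.prod_range_succ, Finset.prod_range]
  simp only [Nat.sub_add_cancel hr]
  congr 1
  · refine Finset.prod_congr rfl fun i _ => ?_
    have h3 : 0 < ρ i := hpos.trans_le (hle i i.2)
    have h4 := (one_sub_sq_div_sq_mem hpos (hle i i.2))
    have e3 : 1 + (ρ i / ρ (r - 1)) ^ 2 * t ^ 2 = (ρ i / ρ (r - 1)) ^ 2 *
        ((1 + t ^ 2) * (1 - (1 - ρ (r - 1) ^ 2 / ρ i ^ 2) * (1 + t ^ 2)⁻¹)) := by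
      field_simp
      ring
    have h5 : 0 ≤ 1 - (1 - ρ (r - 1) ^ 2 / ρ i ^ 2) * (1 + t ^ 2)⁻¹ := by
      rw [sub_nonneg]
      exact mul_le_one₀ h4.2.le (by positivity) (inv_le_one_of_one_le₀ (by nlinarith))
    rw [e3, Real.mul_rpow (by positivity) (by positivity), sq_rpow_neg_half (by positivity),
      Real.mul_rpow ht.le h5, inv_div]
    ring
  · rw [div_self hpos.ne', one_pow, one_mul]

end Weights

/-! ### The mixture law. -/

/-- The mixture of the densities `besselDensity` with the weights `multiCoeff`. -/
noncomputable def mixDensity (r : ℕ) (ρ : ℕ → ℝ) (u : ℝ) : ℝ :=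
  ∑' κ : Fin (r - 1) → ℕ,
    multiCoeff r ρ κ * besselDensity (((r : ℝ) - 1) / 2 + ∑ i, (κ i : ℝ)) u

section Mixture

variable {r : ℕ} {ρ : ℕ → ℝ}

lemma half_le_order (hr : 2 ≤ r) (κ : Fin (r - 1) → ℕ) :
    1 / 2 ≤ ((r : ℝ) - 1) / 2 + ∑ i, (κ i : ℝ) := by
  have h1 : (2 : ℝ) ≤ r := by exact_mod_cast hr
  have h2 : 0 ≤ ∑ i, (κ i : ℝ) := Finset.sum_nonneg fun i _ => Nat.cast_nonneg _
  linarith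

lemma order_pos (hr : 2 ≤ r) (κ : Fin (r - 1) → ℕ) :
    0 < ((r : ℝ) - 1) / 2 + ∑ i, (κ i : ℝ) := by
  linarith [half_le_order hr κ]

lemma norm_mixDensity_term_le (hr : 2 ≤ r) (hpos : 0 < ρ (r - 1))
    (hle : ∀ i < r - 1, ρ (r - 1) ≤ ρ i) (κ : Fin (r - 1) → ℕ) (u : ℝ) :
    ‖multiCoeff r ρ κ * besselDensity (((r : ℝ) - 1) / 2 + ∑ i, (κ i : ℝ)) u‖ ≤
      multiCoeff r ρ κ := by
  have h0 := multiCoeff_nonneg hpos hle κ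
  rw [Real.norm_of_nonneg (mul_nonneg h0 (besselDensity_nonneg (order_pos hr κ) u))]
  exact mul_le_of_le_one_right h0 (besselDensity_le_one (half_le_order hr κ) u)

lemma hasSum_mixDensity (hr : 2 ≤ r) (hpos : 0 < ρ (r - 1))
    (hle : ∀ i < r - 1, ρ (r - 1) ≤ ρ i) (u : ℝ) :
    HasSum (fun κ : Fin (r - 1) → ℕ =>
      multiCoeff r ρ κ * besselDensity (((r : ℝ) - 1) / 2 + ∑ i, (κ i : ℝ)) u)
      (mixDensity r ρ u) :=
  (Summable.of_norm_bounded (hasSum_multiCoeff hpos hle).summable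
    fun κ => norm_mixDensity_term_le hr hpos hle κ u).hasSum

lemma continuous_mixDensity (hr : 2 ≤ r) (hpos : 0 < ρ (r - 1))
    (hle : ∀ i < r - 1, ρ (r - 1) ≤ ρ i) : Continuous (mixDensity r ρ) :=
  continuous_tsum (fun κ => (continuous_besselDensity (order_pos hr κ)).const_mul _)
    (hasSum_multiCoeff hpos hle).summable fun κ u => norm_mixDensity_term_le hr hpos hle κ u

lemma mixDensity_nonneg (hr : 2 ≤ r) (hpos : 0 < ρ (r - 1))
    (hle : ∀ i < r - 1, ρ (r - 1) ≤ ρ i) (u : ℝ) : 0 ≤ mixDensity r ρ u :=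
  tsum_nonneg fun κ => mul_nonneg (multiCoeff_nonneg hpos hle κ)
    (besselDensity_nonneg (order_pos hr κ) u)

lemma mixDensity_neg (u : ℝ) : mixDensity r ρ (-u) = mixDensity r ρ u := by
  simp only [mixDensity, besselDensity_neg]

/-- The probability measure with density `mixDensity`. -/
noncomputable def mixMeasure (r : ℕ) (ρ : ℕ → ℝ) : Measure ℝ :=
  volume.withDensity fun u => ENNReal.ofReal (mixDensity r ρ u)

lemma lintegral_mixDensity (hr : 2 ≤ r) (hpos : 0 < ρ (r - 1))
    (hle : ∀ i < r - 1, ρ (r - 1) ≤ ρ i) :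
    ∫⁻ u, ENNReal.ofReal (mixDensity r ρ u) = 1 := by
  have h0 := multiCoeff_nonneg hpos hle
  have hb := fun κ u => besselDensity_nonneg (order_pos hr κ) u
  have h1 : ∀ u, ENNReal.ofReal (mixDensity r ρ u) = ∑' κ : Fin (r - 1) → ℕ,
      ENNReal.ofReal (multiCoeff r ρ κ *
        besselDensity (((r : ℝ) - 1) / 2 + ∑ i, (κ i : ℝ)) u) := fun u =>
    ENNReal.ofReal_tsum_of_nonneg (fun κ => mul_nonneg (h0 κ) (hb κ u))
      (hasSum_mixDensity hr hpos hle u).summable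
  simp_rw [h1]
  rw [lintegral_tsum fun κ => ((continuous_besselDensity
    (order_pos hr κ)).const_mul _).measurable.ennreal_ofReal.aemeasurable]
  have h2 : ∀ κ : Fin (r - 1) → ℕ, ∫⁻ u, ENNReal.ofReal (multiCoeff r ρ κ *
        besselDensity (((r : ℝ) - 1) / 2 + ∑ i, (κ i : ℝ)) u) =
      ENNReal.ofReal (multiCoeff r ρ κ) := by
    intro κ
    rw [← ofReal_integral_eq_lintegral_ofReal
      ((integrable_besselDensity (order_pos hr κ)).const_mul _)
      (ae_of_all _ fun u => mul_nonneg (h0 κ) (hb κ u)), integral_const_mul,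
      integral_besselDensity (order_pos hr κ), mul_one]
  simp_rw [h2]
  rw [← ENNReal.ofReal_tsum_of_nonneg h0 (hasSum_multiCoeff hpos hle).summable,
    (hasSum_multiCoeff hpos hle).tsum_eq, ENNReal.ofReal_one]

lemma isProbabilityMeasure_mixMeasure (hr : 2 ≤ r) (hpos : 0 < ρ (r - 1))
    (hle : ∀ i < r - 1, ρ (r - 1) ≤ ρ i) : IsProbabilityMeasure (mixMeasure r ρ) :=
  ⟨by rw [mixMeasure, withDensity_apply _ MeasurableSet.univ, setLIntegral_univ,
    lintegral_mixDensity hr hpos hle]⟩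

lemma integrable_mixDensity (hr : 2 ≤ r) (hpos : 0 < ρ (r - 1))
    (hle : ∀ i < r - 1, ρ (r - 1) ≤ ρ i) : Integrable (mixDensity r ρ) := by
  refine (lintegral_ofReal_ne_top_iff_integrable
    (continuous_mixDensity hr hpos hle).aestronglyMeasurable
    (ae_of_all _ (mixDensity_nonneg hr hpos hle))).1 ?_
  rw [lintegral_mixDensity hr hpos hle]
  exact ENNReal.one_ne_top

/-- Termwise integration is allowed because the `L¹` norms of the terms are the weights themselves.
-/
lemma charFun_mixMeasure (hr : 2 ≤ r) (hpos : 0 < ρ (r - 1))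
    (hle : ∀ i < r - 1, ρ (r - 1) ≤ ρ i) (t : ℝ) :
    charFun (mixMeasure r ρ) t =
      ((∏ i ∈ Finset.range r, (1 + (ρ i / ρ (r - 1)) ^ 2 * t ^ 2) ^ (-(1 / 2) : ℝ) : ℝ) : ℂ) := by
  have hm : Measurable fun u => (mixDensity r ρ u).toNNReal :=
    (continuous_mixDensity hr hpos hle).measurable.real_toNNReal
  have hexp : ∀ u : ℝ, ‖Complex.exp (t * u * Complex.I)‖ = 1 := fun u => by
    rw [← Complex.ofReal_mul, Complex.norm_exp_ofReal_mul_I]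
  have h1 := hasSum_integral_of_summable_integral_norm (μ := volume)
    (F := fun (κ : Fin (r - 1) → ℕ) (u : ℝ) => (multiCoeff r ρ κ : ℂ) *
      (Complex.exp (t * u * Complex.I) *
        (besselDensity (((r : ℝ) - 1) / 2 + ∑ i, (κ i : ℝ)) u : ℂ))) ?_ ?_
  · have h2 : ∀ κ : Fin (r - 1) → ℕ, ∫ u : ℝ, (multiCoeff r ρ κ : ℂ) *
      (Complex.exp (t * u * Complex.I) *
        (besselDensity (((r : ℝ) - 1) / 2 + ∑ i, (κ i : ℝ)) u : ℂ)) =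
        ((multiCoeff r ρ κ *
        (1 + t ^ 2) ^ (-(((r : ℝ) - 1) / 2 + ∑ i, (κ i : ℝ) + 1 / 2)) : ℝ) : ℂ) := by
      intro κ
      rw [integral_const_mul, integral_cexp_mul_besselDensity (order_pos hr κ), Complex.ofReal_mul]
    simp_rw [h2] at h1
    have h4 := (hasSum_multiCoeff_mul_rpow (by omega) hpos hle t).mapL Complex.ofRealCLM
    simp only [Complex.ofRealCLM_apply] at h4
    rw [← h1.unique h4, charFun_apply_real, mixMeasure]
    change ∫ x, _ ∂(volume.withDensity fun u => ((mixDensity r ρ u).toNNReal : ENNReal)) = _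
    rw [integral_withDensity_eq_integral_smul hm]
    refine integral_congr_ae (ae_of_all _ fun u => ?_)
    have h3 := ((hasSum_mixDensity hr hpos hle u).mapL Complex.ofRealCLM).mul_left
      (Complex.exp (t * u * Complex.I))
    simp only [NNReal.smul_def, Real.coe_toNNReal _ (mixDensity_nonneg hr hpos hle u),
      Complex.real_smul]
    rw [mul_comm]
    refine h3.tsum_eq.symm.trans (tsum_congr fun κ => ?_)
    simp only [Complex.ofRealCLM_apply, Complex.ofReal_mul]
    ring
  · intro κ
    refine (Integrable.bdd_mul (c := 1) (integrable_besselDensity (order_pos hr κ)).ofReal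
      ?_ (ae_of_all _ fun u => (hexp u).le)).const_mul _
    exact Measurable.aestronglyMeasurable (by fun_prop)
  · refine (hasSum_multiCoeff hpos hle).summable.congr fun κ => ?_
    have h0 := multiCoeff_nonneg hpos hle κ
    have hb := fun u => besselDensity_nonneg (order_pos hr κ) u
    simp_rw [norm_mul, hexp, one_mul, Complex.norm_of_nonneg h0, Complex.norm_of_nonneg (hb _)]
    rw [integral_const_mul, integral_besselDensity (order_pos hr κ), mul_one]

lemma hasSum_integral_mixDensity (hr : 2 ≤ r) (hpos : 0 < ρ (r - 1))
    (hle : ∀ i < r - 1, ρ (r - 1) ≤ ρ i) {w : ℝ} (hw : 0 < w) :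
    HasSum (fun κ : Fin (r - 1) → ℕ => multiCoeff r ρ κ *
        (w / 2 * (besselK (((r : ℝ) - 1) / 2 + ∑ i, (κ i : ℝ)) w *
          struveL (((r : ℝ) - 3) / 2 + ∑ i, (κ i : ℝ)) w +
          besselK (((r : ℝ) - 3) / 2 + ∑ i, (κ i : ℝ)) w *
          struveL (((r : ℝ) - 1) / 2 + ∑ i, (κ i : ℝ)) w)))
      (∫ u in (0 : ℝ)..w, mixDensity r ρ u) := by
  have h := intervalIntegral.hasSum_integral_of_dominated_convergence (μ := volume) (a := 0) (b := w)
    (F := fun (κ : Fin (r - 1) → ℕ) u =>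
      multiCoeff r ρ κ * besselDensity (((r : ℝ) - 1) / 2 + ∑ i, (κ i : ℝ)) u)
    (f := mixDensity r ρ) (fun κ _ => multiCoeff r ρ κ)
    (fun κ => ((continuous_besselDensity (order_pos hr κ)).const_mul _).aestronglyMeasurable)
    (fun κ => ae_of_all _ fun u _ => norm_mixDensity_term_le hr hpos hle κ u)
    (ae_of_all _ fun _ _ => (hasSum_multiCoeff hpos hle).summable)
    intervalIntegrable_const
    (ae_of_all _ fun u _ => hasSum_mixDensity hr hpos hle u)
  have e : ∀ κ : Fin (r - 1) → ℕ, ((r : ℝ) - 3) / 2 + ∑ i, (κ i : ℝ) =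
      ((r : ℝ) - 1) / 2 + ∑ i, (κ i : ℝ) - 1 := fun κ => by ring
  have e2 := fun κ : Fin (r - 1) → ℕ => integral_besselInt (half_le_order hr κ) hw
  simp_rw [e, ← e2, ← intervalIntegral.integral_const_mul]
  exact h

/-- Evenness of the density puts mass `1/2` on the negative half-line; for `w < 0` the interval
integral is negative. -/
lemma mixMeasure_real_Iic (hr : 2 ≤ r) (hpos : 0 < ρ (r - 1))
    (hle : ∀ i < r - 1, ρ (r - 1) ≤ ρ i) (w : ℝ) :
    (mixMeasure r ρ).real (Iic w) = 1 / 2 + ∫ u in (0 : ℝ)..w, mixDensity r ρ u := by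
  have hint := integrable_mixDensity hr hpos hle
  have h1 : ∀ s, MeasurableSet s → (mixMeasure r ρ).real s = ∫ u in s, mixDensity r ρ u := by
    intro s hs
    rw [Measure.real, mixMeasure, withDensity_apply _ hs, ← ofReal_integral_eq_lintegral_ofReal
      hint.integrableOn (ae_of_all _ (mixDensity_nonneg hr hpos hle)), ENNReal.toReal_ofReal
      (integral_nonneg (mixDensity_nonneg hr hpos hle))]
  have htot : ∫ u, mixDensity r ρ u = 1 := by
    have := isProbabilityMeasure_mixMeasure hr hpos hle
    rw [← setIntegral_univ, ← h1 _ MeasurableSet.univ, probReal_univ]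
  have hsym : ∫ u in Iic 0, mixDensity r ρ u = ∫ u in Ioi 0, mixDensity r ρ u := by
    have := integral_comp_neg_Iic 0 (mixDensity r ρ)
    simpa [mixDensity_neg] using this
  have hhalf : ∫ u in Iic 0, mixDensity r ρ u = 1 / 2 := by
    have := integral_add_compl (measurableSet_Iic (a := (0 : ℝ))) hint
    rw [compl_Iic, ← hsym, htot] at this
    linarith
  rw [h1 _ measurableSet_Iic, ← hhalf, ← intervalIntegral.integral_Iic_sub_Iic hint.integrableOn
    hint.integrableOn]
  ring

end Mixture

/-! ### Spectrum of the off-diagonal block matrix. -/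

section LinearAlgebra

open Matrix Polynomial

/-- For `z ≠ 0` the determinant is `z ^ n` times the characteristic polynomial at `z⁻¹`. Complex `z`
is needed for the value `i t`. -/
lemma det_one_sub_smul_map {n : Type*} [Fintype n] [DecidableEq n] {A : Matrix n n ℝ}
    {ι : Type*} [Fintype ι] {a : ι → ℝ} (hcard : Fintype.card ι = Fintype.card n)
    (hA : A.charpoly = ∏ i, (X - C (a i))) (z : ℂ) :
    (1 - z • A.map Complex.ofReal).det = ∏ i, (1 - z * a i) := by
  rcases eq_or_ne z 0 with rfl | hz
  · simp
  have h1 : (1 : Matrix n n ℂ) - z • A.map Complex.ofReal =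
      z • (scalar n z⁻¹ - A.map Complex.ofReal) := by
    rw [smul_sub]
    congr 1
    ext i j
    simp [Matrix.scalar_apply, Matrix.one_apply, Matrix.diagonal_apply, hz]
  have h2 : (scalar n z⁻¹ - A.map Complex.ofReal).det = ∏ i, (z⁻¹ - a i) := by
    rw [← eval_charpoly]
    have : (A.map Complex.ofReal).charpoly = A.charpoly.map Complex.ofRealHom :=
      Matrix.charpoly_map A Complex.ofRealHom
    rw [this, hA, Polynomial.map_prod, Polynomial.eval_prod]
    simp
  rw [h1, det_smul, h2, ← hcard, ← Finset.card_univ, ← Finset.prod_const, ← Finset.prod_mul_distrib]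
  refine Finset.prod_congr rfl fun i _ => ?_
  rw [mul_sub, mul_inv_cancel₀ hz]

/-- The symmetric block matrix with off-diagonal blocks `M` and `Mᵀ`. -/
def offDiag {p q : ℕ} (M : Matrix (Fin p) (Fin q) ℝ) : Matrix (Fin p ⊕ Fin q) (Fin p ⊕ Fin q) ℝ :=
  fromBlocks 0 M Mᵀ 0

lemma isHermitian_offDiag {p q : ℕ} (M : Matrix (Fin p) (Fin q) ℝ) : (offDiag M).IsHermitian := by
  simp [offDiag, IsHermitian, fromBlocks_transpose, conjTranspose_eq_transpose_of_trivial]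

lemma sum_eigenvalues_offDiag {p q : ℕ} (M : Matrix (Fin p) (Fin q) ℝ) :
    ∑ j, (isHermitian_offDiag M).eigenvalues j = 0 := by
  have h := (isHermitian_offDiag M).trace_eq_sum_eigenvalues
  have h0 : (offDiag M).trace = 0 := by simp [offDiag, Matrix.trace]
  rw [h0] at h
  exact h.symm

lemma charpoly_transpose_mul_self {p q : ℕ} (M : Matrix (Fin p) (Fin q) ℝ) :
    (Mᵀ * M).charpoly =
      ∏ i : Fin q, (X - C ((toEuclideanLin M).singularValues i ^ 2)) := by
  have hn : Module.finrank ℝ (EuclideanSpace ℝ (Fin q)) = q := by simp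
  have h := ((toEuclideanLin M).isSymmetric_adjoint_comp_self).charpoly_eq hn
  simp_rw [LinearMap.sq_singularValues_fin _ hn]
  have h2 : LinearMap.adjoint (toEuclideanLin M) ∘ₗ toEuclideanLin M =
      toEuclideanLin (Mᵀ * M) := by
    rw [← toEuclideanLin_conjTranspose_eq_adjoint, conjTranspose_eq_transpose_of_trivial,
      toEuclideanLin, toEuclideanLin, toLpLin_mul_same]
  refine Eq.trans ?_ h
  rw [h2, toEuclideanLin_eq_toLin_orthonormal]
  exact (Matrix.charpoly_toLin _ _).symm

lemma rank_eq_finrank_range_toEuclideanLin {p q : ℕ} (M : Matrix (Fin p) (Fin q) ℝ) :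
    M.rank = Module.finrank ℝ (LinearMap.range (toEuclideanLin M)) := by
  rw [toEuclideanLin_eq_toLin_orthonormal]
  exact rank_eq_finrank_range_toLin M _ _

/-- Both sides are `det (1 - z • offDiag M)`; the Schur complement reduces it to `det (1 - z² MᵀM)`,
so the eigenvalues need not be listed. Singular values beyond the rank vanish and contribute the
factor `1`. -/
lemma prod_one_sub_eigenvalues_offDiag {p q : ℕ} (M : Matrix (Fin p) (Fin q) ℝ) {r : ℕ}
    (hr : r = M.rank) (z : ℂ) :
    ∏ j, (1 - z * (isHermitian_offDiag M).eigenvalues j) =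
      ∏ i ∈ Finset.range r, (1 - z ^ 2 * (toEuclideanLin M).singularValues i ^ 2) := by
  rw [← det_one_sub_smul_map rfl (by exact (isHermitian_offDiag M).charpoly_eq)]
  have h1 : (1 : Matrix (Fin p ⊕ Fin q) (Fin p ⊕ Fin q) ℂ) - z • (offDiag M).map Complex.ofReal =
      fromBlocks 1 (-(z • M.map Complex.ofReal)) (-(z • Mᵀ.map Complex.ofReal)) 1 := by
    rw [← fromBlocks_one, offDiag, fromBlocks_map, fromBlocks_smul, sub_eq_add_neg,
      fromBlocks_neg, fromBlocks_add]
    simp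
  have h2 : (1 : Matrix (Fin q) (Fin q) ℂ) - -(z • Mᵀ.map Complex.ofReal) *
      -(z • M.map Complex.ofReal) = 1 - (z ^ 2) • (Mᵀ * M).map Complex.ofReal := by
    have : (Mᵀ * M).map Complex.ofReal = Mᵀ.map Complex.ofReal * M.map Complex.ofReal :=
      Matrix.map_mul (f := Complex.ofRealHom)
    rw [this, Matrix.neg_mul, Matrix.mul_neg, neg_neg, Matrix.smul_mul, Matrix.mul_smul, smul_smul,
      sq]
  rw [h1, det_fromBlocks_one₁₁, h2, det_one_sub_smul_map rfl (charpoly_transpose_mul_self M)]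
  simp only [Complex.ofReal_pow]
  rw [← Finset.prod_range fun i =>
    (1 - z ^ 2 * ((toEuclideanLin M).singularValues i : ℂ) ^ 2)]
  symm
  refine Finset.prod_subset ?_ fun i _ hi => ?_
  · rw [Finset.range_subset_range, hr]
    simpa using M.rank_le_card_width
  · have : (toEuclideanLin M).singularValues i = 0 := by
      rw [LinearMap.singularValues_eq_zero_iff_le_finrank_range,
        ← rank_eq_finrank_range_toEuclideanLin, ← hr]
      simpa using hi
    simp [this]

end LinearAlgebra

/-! ### Covariance matrices, whitening and decorrelation. -/

section Whitening

open Matrix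

variable {Ω : Type*} [MeasurableSpace Ω] {P : Measure Ω}

lemma posSemidef_covMat [IsProbabilityMeasure P] {p : ℕ} {ξ : Ω → Fin p → ℝ}
    (hξ : ∀ i, MemLp (fun ω => ξ ω i) 2 P) : (covMat P ξ).PosSemidef := by
  refine PosSemidef.of_dotProduct_mulVec_nonneg ?_ fun x => ?_
  · ext i j
    simp [covMat, crossCov, covariance_comm]
  · have h := variance_nonneg (fun ω => ∑ i, x i * ξ ω i) P
    rw [← covariance_self, covariance_fun_sum_fun_sum (fun i => (hξ i).const_mul _)
      (fun i => (hξ i).const_mul _)] at h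
    · refine h.trans_eq ?_
      simp only [covariance_const_mul_left, covariance_const_mul_right, dotProduct, mulVec, covMat,
        crossCov, of_apply, star_trivial, Finset.mul_sum]
      refine Finset.sum_congr rfl fun i _ => Finset.sum_congr rfl fun j _ => ?_
      ring
    · exact Finset.aemeasurable_fun_sum _ fun i _ => ((hξ i).const_mul _).aestronglyMeasurable.aemeasurable

lemma sqrt_mul_sqrt {p : ℕ} {R : Matrix (Fin p) (Fin p) ℝ} (hR : R.PosSemidef) :
    cfc Real.sqrt R * cfc Real.sqrt R = R := by
  have hs : IsSelfAdjoint R := hR.isHermitian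
  rw [← cfc_mul Real.sqrt Real.sqrt R]
  conv_rhs => rw [← cfc_id ℝ R hs]
  refine cfc_congr fun x hx => ?_
  rw [hR.isHermitian.spectrum_real_eq_range_eigenvalues] at hx
  obtain ⟨i, rfl⟩ := hx
  exact Real.mul_self_sqrt (hR.eigenvalues_nonneg i)

lemma isUnit_cfc_sqrt {p : ℕ} {R : Matrix (Fin p) (Fin p) ℝ} (hR : R.PosSemidef)
    (hu : IsUnit R) : IsUnit (cfc Real.sqrt R).det := by
  rw [← sqrt_mul_sqrt hR, isUnit_iff_isUnit_det, det_mul] at hu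
  exact isUnit_of_mul_isUnit_left hu

lemma invSqrt_transpose {p : ℕ} (R : Matrix (Fin p) (Fin p) ℝ) : (invSqrt R)ᵀ = invSqrt R := by
  have h : (cfc Real.sqrt R).IsHermitian := cfc_predicate Real.sqrt R
  rw [← conjTranspose_eq_transpose_of_trivial]
  exact h.inv

lemma isUnit_det_invSqrt {p : ℕ} {R : Matrix (Fin p) (Fin p) ℝ} (hR : R.PosSemidef)
    (hu : IsUnit R) : IsUnit (invSqrt R).det := by
  rw [invSqrt, isUnit_nonsing_inv_det_iff]
  exact isUnit_cfc_sqrt hR hu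

lemma invSqrt_mul_mul_invSqrt {p : ℕ} {R : Matrix (Fin p) (Fin p) ℝ} (hR : R.PosSemidef)
    (hu : IsUnit R) : invSqrt R * R * invSqrt R = 1 := by
  have h := isUnit_cfc_sqrt hR hu
  have e : invSqrt R * R * invSqrt R = (cfc Real.sqrt R)⁻¹ *
      (cfc Real.sqrt R * cfc Real.sqrt R) * (cfc Real.sqrt R)⁻¹ := by
    rw [sqrt_mul_sqrt hR, invSqrt]
  rw [e, ← mul_assoc, nonsing_inv_mul _ h, one_mul, mul_nonsing_inv _ h]

/-- Decorrelating coordinates of a Gaussian vector are independent centred Gaussians. -/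
lemma map_mulVec_eq_pi_gaussianReal {ι κ : Type*} [Fintype ι] [Fintype κ] [DecidableEq κ]
    [IsProbabilityMeasure P] {Z : Ω → ι → ℝ} (hZ : HasGaussianLaw Z P) (T : Matrix κ ι ℝ)
    (m : ι → ℝ) (hm : ∀ k, ∫ ω, Z ω k ∂P = m k) {K : Matrix ι ι ℝ}
    (hK : ∀ k l, cov[fun ω => Z ω k, fun ω => Z ω l; P] = K k l) (lam : κ → ℝ)
    (hT : T * K * Tᵀ = diagonal lam) :
    P.map (fun ω => T *ᵥ (Z ω - m)) = Measure.pi fun j => gaussianReal 0 (lam j).toNNReal := by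
  set X : κ → Ω → ℝ := fun j ω => (T *ᵥ (Z ω - m)) j with hX
  have hZk : ∀ k, MemLp (fun ω => Z ω k - m k) 2 P := fun k =>
    (hZ.eval k).memLp_two.sub (memLp_const _)
  have hXsum : ∀ j, X j = fun ω => ∑ k, T j k * (Z ω k - m k) := fun j => rfl
  have hXg : HasGaussianLaw (fun ω j => X j ω) P := by
    have h1 : HasGaussianLaw (fun ω => T *ᵥ Z ω) P :=
      hZ.map_fun (LinearMap.toContinuousLinearMap T.mulVecLin)
    have h2 : (fun ω j => X j ω) = (fun x => x - T *ᵥ m) ∘ fun ω => T *ᵥ Z ω := by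
      ext ω j
      simp [hX, mulVec_sub]
    refine ⟨?_⟩
    rw [h2, ← AEMeasurable.map_map_of_aemeasurable (by fun_prop) h1.aemeasurable]
    have := h1.isGaussian_map
    infer_instance
  have hcov : ∀ i j, cov[X i, X j; P] = diagonal lam i j := by
    intro i j
    rw [← hT, hXsum, hXsum, covariance_fun_sum_fun_sum (fun k => (hZk k).const_mul _)
      (fun k => (hZk k).const_mul _)]
    simp only [covariance_const_mul_left, covariance_const_mul_right, mul_apply, transpose_apply]
    rw [Finset.sum_comm]
    refine Finset.sum_congr rfl fun l _ => ?_
    rw [Finset.sum_mul]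
    refine Finset.sum_congr rfl fun k _ => ?_
    rw [covariance_sub_const_left (hZ.eval k).integrable,
      covariance_sub_const_right (hZ.eval l).integrable, hK]
    ring
  have hmean : ∀ j, ∫ ω, X j ω ∂P = 0 := by
    intro j
    rw [hXsum, integral_finsetSum _ fun k _ => ((hZk k).integrable one_le_two).const_mul _]
    refine Finset.sum_eq_zero fun k _ => ?_
    rw [integral_const_mul, integral_sub (hZ.eval k).integrable (integrable_const _), hm]
    simp
  -- For jointly Gaussian coordinates, zero covariance implies independence.
  have hind : iIndepFun X P := hXg.iIndepFun_of_covariance_eq_zero fun i j hij => by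
    rw [hcov, diagonal_apply_ne _ hij]
  have := (iIndepFun_iff_map_fun_eq_pi_map fun j => (hXg.eval j).aemeasurable).1 hind
  change P.map (fun ω j => X j ω) = _
  rw [this]
  congr 1
  ext1 j
  rw [(hXg.eval j).map_eq_gaussianReal, hmean, ← covariance_self (hXg.eval j).aemeasurable, hcov,
    diagonal_apply_eq]

end Whitening

/-! ### Relative densities and characteristic functions of Gaussian squares. -/

section Densities

open scoped ENNReal

/-- On a box the integrand with its indicator is a product of functions of independent coordinates,
so the integral factorizes. -/
lemma pi_withDensity_prod {ι : Type*} [Fintype ι] {E : ι → Type*} [∀ i, MeasurableSpace (E i)]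
    (μ : ∀ i, Measure (E i)) [∀ i, IsProbabilityMeasure (μ i)] {f : ∀ i, E i → ℝ≥0∞}
    (hf : ∀ i, Measurable (f i)) [∀ i, SigmaFinite ((μ i).withDensity (f i))] :
    Measure.pi (fun i => (μ i).withDensity (f i)) =
      (Measure.pi μ).withDensity fun x => ∏ i, f i (x i) := by
  refine Measure.pi_eq fun s hs => ?_
  have hm : ∀ i, Measurable ((s i).indicator (f i)) := fun i => (hf i).indicator (hs i)
  rw [withDensity_apply _ (MeasurableSet.univ_pi hs),
    ← lintegral_indicator (MeasurableSet.univ_pi hs)]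
  have h1 : (univ.pi s).indicator (fun x => ∏ i, f i (x i)) =
      fun x => ∏ i, (s i).indicator (f i) (x i) := by
    ext x
    by_cases hx : x ∈ univ.pi s
    · rw [indicator_of_mem hx]
      exact Finset.prod_congr rfl fun i _ => (indicator_of_mem (hx i (mem_univ i)) _).symm
    · rw [indicator_of_notMem hx]
      simp only [mem_univ_pi, not_forall] at hx
      obtain ⟨i, hi⟩ := hx
      exact (Finset.prod_eq_zero (Finset.mem_univ i) (indicator_of_notMem hi _)).symm
  have hind := iIndepFun_pi (μ := μ) (X := fun i => (s i).indicator (f i))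
    fun i => (hm i).aemeasurable
  simp only [h1]
  rw [lintegral_prod_eq_prod_lintegral_of_indepFun Finset.univ
    (fun i (x : ∀ i, E i) => (s i).indicator (f i) (x i)) hind fun i => (hm i).comp (measurable_pi_apply i)]
  refine Finset.prod_congr rfl fun i _ => ?_
  rw [withDensity_apply _ (hs i), ← lintegral_indicator (hs i),
    ← (measurePreserving_eval μ i).lintegral_comp (hm i)]

/-- The density of the centred Gaussian with variance `v` relative to the standard Gaussian. -/
noncomputable def gaussianRatio (v w : ℝ) : ℝ :=
  Real.exp (-(1 / 2) * Real.log v + 1 / 2 * (1 - 1 / v) * w ^ 2)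

lemma gaussianReal_eq_withDensity {v : ℝ} (hv : 0 < v) :
    gaussianReal 0 v.toNNReal =
      (gaussianReal 0 1).withDensity fun w => ENNReal.ofReal (gaussianRatio v w) := by
  have hv' : v.toNNReal ≠ 0 := by simpa using hv
  rw [gaussianReal_of_var_ne_zero _ hv', gaussianReal_of_var_ne_zero _ one_ne_zero,
    ← withDensity_mul _ (measurable_gaussianPDF _ _) (by unfold gaussianRatio; fun_prop)]
  congr 1
  ext w
  simp only [Pi.mul_apply, gaussianPDF]
  rw [← ENNReal.ofReal_mul (gaussianPDFReal_nonneg _ _ _)]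
  congr 1
  simp only [gaussianPDFReal, gaussianRatio, Real.coe_toNNReal _ hv.le, NNReal.coe_one, sub_zero,
    mul_one]
  have e : Real.exp (-(1 / 2) * Real.log v) = (√v)⁻¹ := by
    rw [mul_comm, Real.exp_mul, Real.exp_log hv, Real.rpow_neg hv.le, Real.sqrt_eq_rpow]
  have e2 : Real.exp (-w ^ 2 / (2 * v)) =
      Real.exp (-w ^ 2 / 2) * Real.exp (1 / 2 * (1 - 1 / v) * w ^ 2) := by
    rw [← Real.exp_add]
    congr 1
    field_simp
    ring
  rw [Real.exp_add, e, e2, Real.sqrt_mul (by positivity), mul_inv]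
  ring

/-- An embedding loses no information: every measurable set is the preimage of its measurable image,
so the density pulls back. -/
lemma rnDeriv_of_map_eq_withDensity {E F : Type*} [MeasurableSpace E] [MeasurableSpace F]
    {μ ν : Measure E} [SigmaFinite ν] {W : E → F} (hW : MeasurableEmbedding W) {g : F → ℝ≥0∞}
    (hg : Measurable g) (h : μ.map W = (ν.map W).withDensity g) :
    μ.rnDeriv ν =ᵐ[ν] g ∘ W := by
  have : μ = ν.withDensity (g ∘ W) := by
    ext s hs
    have hs' := hW.measurableSet_image.2 hs
    have e : W ⁻¹' (W '' s) = s := preimage_image_eq s hW.injective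
    have h1 : μ s = μ.map W (W '' s) := by rw [Measure.map_apply hW.measurable hs', e]
    rw [h1, h, withDensity_apply _ hs', setLIntegral_map hs' hg hW.measurable, e,
      withDensity_apply _ hs]
    rfl
  rw [this]
  exact Measure.rnDeriv_withDensity ν (hg.comp hW.measurable)

/-- The square of the characteristic function of `½ (1 - 1/v) w²`, with `w` a centred Gaussian of
variance `v`. -/
lemma sq_integral_cexp_mul_sq {v : ℝ} (hv : 0 < v) (t : ℝ) :
    (∫ w, Complex.exp ((t * (1 / 2 * (1 - 1 / v) * w ^ 2) : ℝ) * Complex.I)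
      ∂(gaussianReal 0 v.toNNReal)) ^ 2 * (1 - (Complex.I * t) * (v - 1 : ℝ)) = 1 := by
  have hv' : v.toNNReal ≠ 0 := by simpa using hv
  have hvC : (v : ℂ) ≠ 0 := by exact_mod_cast hv.ne'
  -- The integrand is a constant times `exp (-b w²)`, and `1 - i t (v - 1) = 2 v b`.
  set b : ℂ := 1 / (2 * v) - Complex.I * t * (1 / 2 * (1 - 1 / v)) with hb
  have hbre : 0 < b.re := by
    have : b = ((1 / (2 * v) : ℝ) : ℂ) - ((t * (1 / 2 * (1 - 1 / v)) : ℝ) : ℂ) * Complex.I := by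
      rw [hb]; push_cast; ring
    rw [this]
    simp only [Complex.sub_re, Complex.ofReal_re, Complex.re_ofReal_mul, Complex.I_re, mul_zero,
      sub_zero]
    positivity
  have hb0 : b ≠ 0 := fun h => by simp [h] at hbre
  have h1 : ∫ w, Complex.exp ((t * (1 / 2 * (1 - 1 / v) * w ^ 2) : ℝ) * Complex.I)
      ∂(gaussianReal 0 v.toNNReal) = ((√(2 * Real.pi * v))⁻¹ : ℝ) * (Real.pi / b) ^ (1 / 2 : ℂ) := by
    rw [integral_gaussianReal_eq_integral_smul hv', ← integral_gaussian_complex hbre,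
      ← integral_const_mul]
    refine integral_congr_ae (ae_of_all _ fun w => ?_)
    simp only [gaussianPDFReal, Real.coe_toNNReal _ hv.le, sub_zero, Complex.real_smul,
      Complex.ofReal_mul, mul_assoc]
    congr 1
    rw [Complex.ofReal_exp, ← Complex.exp_add]
    congr 1
    rw [hb]
    push_cast
    field_simp
    ring
  -- Squaring removes the choice of branch of the complex square root.
  have h2 : ((Real.pi / b) ^ (1 / 2 : ℂ)) ^ 2 = Real.pi / b := by
    rw [← Complex.cpow_nat_mul]
    simp
  have h3 : (((√(2 * Real.pi * v))⁻¹ : ℝ) : ℂ) ^ 2 = 1 / (2 * Real.pi * v) := by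
    rw [← Complex.ofReal_pow, inv_pow, Real.sq_sqrt (by positivity)]
    push_cast
    rw [one_div]
  have hπ : (Real.pi : ℂ) ≠ 0 := by exact_mod_cast Real.pi_ne_zero
  rw [h1, mul_pow, h2, h3]
  have h4 : (1 - (Complex.I * t) * (v - 1 : ℝ)) = 2 * v * b := by
    rw [hb]
    push_cast
    field_simp
  rw [h4]
  field_simp

/-- The square of the characteristic function of a centred diagonal quadratic form. -/
lemma sq_charFun_map_sum_sq {ι : Type*} [Fintype ι] {lam : ι → ℝ} (hlam : ∀ j, 0 < lam j) (t : ℝ) :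
    (charFun ((Measure.pi fun j => gaussianReal 0 (lam j).toNNReal).map
      fun w => ∑ j, 1 / 2 * (1 - 1 / lam j) * w j ^ 2) t) ^ 2 *
      ∏ j, (1 - (Complex.I * t) * (lam j - 1 : ℝ)) = 1 := by
  have h : charFun ((Measure.pi fun j => gaussianReal 0 (lam j).toNNReal).map
      fun w => ∑ j, 1 / 2 * (1 - 1 / lam j) * w j ^ 2) t =
      ∏ j, ∫ w, Complex.exp ((t * (1 / 2 * (1 - 1 / lam j) * w ^ 2) : ℝ) * Complex.I)
        ∂(gaussianReal 0 (lam j).toNNReal) := by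
    rw [charFun_apply_real, integral_map (Measurable.aemeasurable (by fun_prop))
      (Measurable.aestronglyMeasurable (by fun_prop)),
      ← integral_fintype_prod_eq_prod (μ := fun j => gaussianReal 0 (lam j).toNNReal)
        (fun j w => Complex.exp ((t * (1 / 2 * (1 - 1 / lam j) * w ^ 2) : ℝ) * Complex.I))]
    refine integral_congr_ae (ae_of_all _ fun w => ?_)
    simp only
    rw [← Complex.exp_sum, ← Finset.sum_mul, ← Complex.ofReal_sum, ← Finset.mul_sum,
      Complex.ofReal_mul]
  rw [h, ← Finset.prod_pow, ← Finset.prod_mul_distrib]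
  exact Finset.prod_eq_one fun j _ => sq_integral_cexp_mul_sq (hlam j) t

end Densities

/-! ### Simultaneous diagonalization of the joint law and the product law. -/

section Gaussian

open Matrix

variable {Ω : Type*} [MeasurableSpace Ω] {P : Measure Ω} {p q : ℕ}
  {ξ : Ω → Fin p → ℝ} {η : Ω → Fin q → ℝ}

/-- The whitened cross-covariance matrix, whose singular values are the canonical correlations. -/
noncomputable def whitenedCov (P : Measure Ω) (ξ : Ω → Fin p → ℝ) (η : Ω → Fin q → ℝ) :
    Matrix (Fin p) (Fin q) ℝ :=
  invSqrt (covMat P ξ) * crossCov P ξ η * invSqrt (covMat P η)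

/-- The eigenvalues of the symmetric block matrix built from the whitened cross-covariance. -/
noncomputable def offDiagEigenvalues (P : Measure Ω) (ξ : Ω → Fin p → ℝ) (η : Ω → Fin q → ℝ) :
    Fin p ⊕ Fin q → ℝ :=
  (isHermitian_offDiag (whitenedCov P ξ η)).eigenvalues

/-- The matrix that whitens `ξ` and `η` and then diagonalizes the joint covariance. -/
noncomputable def diagonalizer (P : Measure Ω) (ξ : Ω → Fin p → ℝ) (η : Ω → Fin q → ℝ) :
    Matrix (Fin p ⊕ Fin q) (Fin p ⊕ Fin q) ℝ :=
  ((isHermitian_offDiag (whitenedCov P ξ η)).eigenvectorUnitary :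
    Matrix (Fin p ⊕ Fin q) (Fin p ⊕ Fin q) ℝ)ᵀ *
    fromBlocks (invSqrt (covMat P ξ)) 0 0 (invSqrt (covMat P η))

section Algebra

lemma eigenvectorUnitary_transpose_mul_self {n : Type*} [Fintype n] [DecidableEq n]
    {A : Matrix n n ℝ} (hA : A.IsHermitian) :
    (hA.eigenvectorUnitary : Matrix n n ℝ)ᵀ * (hA.eigenvectorUnitary : Matrix n n ℝ) = 1 := by
  rw [← conjTranspose_eq_transpose_of_trivial]
  exact Unitary.coe_star_mul_self hA.eigenvectorUnitary

lemma eigenvectorUnitary_transpose_mul_mul {n : Type*} [Fintype n] [DecidableEq n]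
    {A : Matrix n n ℝ} (hA : A.IsHermitian) :
    (hA.eigenvectorUnitary : Matrix n n ℝ)ᵀ * A * (hA.eigenvectorUnitary : Matrix n n ℝ) =
      diagonal hA.eigenvalues := by
  rw [← conjTranspose_eq_transpose_of_trivial]
  have h := hA.conjStarAlgAut_star_eigenvectorUnitary
  rw [Unitary.conjStarAlgAut_star_apply] at h
  exact h

lemma diagonalizer_mul_mul_transpose (K : Matrix (Fin p ⊕ Fin q) (Fin p ⊕ Fin q) ℝ) :
    diagonalizer P ξ η * K * (diagonalizer P ξ η)ᵀ =
      ((isHermitian_offDiag (whitenedCov P ξ η)).eigenvectorUnitary :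
        Matrix (Fin p ⊕ Fin q) (Fin p ⊕ Fin q) ℝ)ᵀ *
      (fromBlocks (invSqrt (covMat P ξ)) 0 0 (invSqrt (covMat P η)) * K *
        fromBlocks (invSqrt (covMat P ξ)) 0 0 (invSqrt (covMat P η))) *
      ((isHermitian_offDiag (whitenedCov P ξ η)).eigenvectorUnitary :
        Matrix (Fin p ⊕ Fin q) (Fin p ⊕ Fin q) ℝ) := by
  simp only [diagonalizer, transpose_mul, transpose_transpose, fromBlocks_transpose,
    invSqrt_transpose, transpose_zero, Matrix.mul_assoc]

lemma diagonalizer_mul_fromBlocks_mul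
    (hξ : (covMat P ξ).PosSemidef) (hξu : IsUnit (covMat P ξ))
    (hη : (covMat P η).PosSemidef) (hηu : IsUnit (covMat P η)) :
    diagonalizer P ξ η * fromBlocks (covMat P ξ) 0 0 (covMat P η) * (diagonalizer P ξ η)ᵀ =
      Matrix.diagonal fun _ => 1 := by
  have h : fromBlocks (invSqrt (covMat P ξ)) 0 0 (invSqrt (covMat P η)) *
      fromBlocks (covMat P ξ) 0 0 (covMat P η) *
      fromBlocks (invSqrt (covMat P ξ)) 0 0 (invSqrt (covMat P η)) = 1 := by
    simp only [fromBlocks_multiply, Matrix.mul_zero, Matrix.zero_mul, add_zero, zero_add,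
      invSqrt_mul_mul_invSqrt hξ hξu, invSqrt_mul_mul_invSqrt hη hηu, fromBlocks_one]
  rw [diagonalizer_mul_mul_transpose, h, Matrix.mul_one, eigenvectorUnitary_transpose_mul_self,
    diagonal_one]

/-- Whitening turns the joint covariance into `1 + offDiag (whitenedCov P ξ η)`, and the orthogonal
eigenvector matrix diagonalizes this while fixing the identity. -/
lemma diagonalizer_mul_jointCov_mul
    (hξ : (covMat P ξ).PosSemidef) (hξu : IsUnit (covMat P ξ))
    (hη : (covMat P η).PosSemidef) (hηu : IsUnit (covMat P η)) :
    diagonalizer P ξ η *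
      fromBlocks (covMat P ξ) (crossCov P ξ η) (crossCov P ξ η)ᵀ (covMat P η) *
      (diagonalizer P ξ η)ᵀ = Matrix.diagonal fun j => 1 + offDiagEigenvalues P ξ η j := by
  have h : fromBlocks (invSqrt (covMat P ξ)) 0 0 (invSqrt (covMat P η)) *
      fromBlocks (covMat P ξ) (crossCov P ξ η) (crossCov P ξ η)ᵀ (covMat P η) *
      fromBlocks (invSqrt (covMat P ξ)) 0 0 (invSqrt (covMat P η)) =
      1 + offDiag (whitenedCov P ξ η) := by
    simp only [fromBlocks_multiply, Matrix.mul_zero, Matrix.zero_mul, add_zero, zero_add,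
      invSqrt_mul_mul_invSqrt hξ hξu, invSqrt_mul_mul_invSqrt hη hηu, offDiag, ← fromBlocks_one,
      fromBlocks_add, whitenedCov, transpose_mul, invSqrt_transpose, Matrix.mul_assoc]
  rw [diagonalizer_mul_mul_transpose, h, Matrix.mul_add, Matrix.add_mul, Matrix.mul_one,
    eigenvectorUnitary_transpose_mul_self, eigenvectorUnitary_transpose_mul_mul, ← diagonal_one,
    diagonal_add]
  rfl

lemma isUnit_diagonalizer
    (hξ : (covMat P ξ).PosSemidef) (hξu : IsUnit (covMat P ξ))
    (hη : (covMat P η).PosSemidef) (hηu : IsUnit (covMat P η)) :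
    IsUnit (diagonalizer P ξ η) := by
  have h := diagonalizer_mul_fromBlocks_mul hξ hξu hη hηu
  rw [Matrix.mul_assoc, diagonal_one] at h
  exact (isUnit_iff_isUnit_det _).2 (isUnit_det_of_right_inverse h)

end Algebra

/-- The mean of the joint vector `(ξ, η)`. -/
noncomputable def jointMean (P : Measure Ω) (ξ : Ω → Fin p → ℝ) (η : Ω → Fin q → ℝ) :
    Fin p ⊕ Fin q → ℝ :=
  Sum.elim (fun i => ∫ ω, ξ ω i ∂P) fun j => ∫ ω, η ω j ∂P

/-- The affine change of coordinates that makes both the joint law and the product of the marginal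
laws of `ξ` and `η` product measures. -/
noncomputable def diagCoord (P : Measure Ω) (ξ : Ω → Fin p → ℝ) (η : Ω → Fin q → ℝ)
    (x : (Fin p → ℝ) × (Fin q → ℝ)) : Fin p ⊕ Fin q → ℝ :=
  diagonalizer P ξ η *ᵥ (Sum.elim x.1 x.2 - jointMean P ξ η)

lemma continuous_sumElim :
    Continuous fun x : (Fin p → ℝ) × (Fin q → ℝ) => (Sum.elim x.1 x.2 : Fin p ⊕ Fin q → ℝ) := by
  refine continuous_pi fun k => ?_
  rcases k with i | j
  · exact (continuous_apply i).comp continuous_fst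
  · exact (continuous_apply j).comp continuous_snd

lemma measurableEmbedding_diagCoord (h : IsUnit (diagonalizer P ξ η)) :
    MeasurableEmbedding (diagCoord P ξ η) := by
  refine Continuous.measurableEmbedding ?_ fun x y hxy => ?_
  · exact Continuous.matrix_mulVec continuous_const (continuous_sumElim.sub continuous_const)
  · have h1 := sub_left_injective (mulVec_injective_of_isUnit h hxy)
    ext i
    · exact congrFun h1 (Sum.inl i)
    · exact congrFun h1 (Sum.inr i)

/-- Concatenation of vectors as a continuous linear map. -/
noncomputable def sumElimCLM (p q : ℕ) : ((Fin p → ℝ) × (Fin q → ℝ)) →L[ℝ] (Fin p ⊕ Fin q → ℝ) where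
  toFun x := Sum.elim x.1 x.2
  map_add' x y := by ext k; rcases k with i | j <;> rfl
  map_smul' c x := by ext k; rcases k with i | j <;> rfl
  cont := continuous_sumElim

lemma map_diagCoord_joint [IsProbabilityMeasure P]
    (hG : HasGaussianLaw (fun ω => (ξ ω, η ω)) P)
    (hξ : (covMat P ξ).PosSemidef) (hξu : IsUnit (covMat P ξ))
    (hη : (covMat P η).PosSemidef) (hηu : IsUnit (covMat P η)) :
    (P.map fun ω => (ξ ω, η ω)).map (diagCoord P ξ η) =
      Measure.pi fun j => gaussianReal 0 (1 + offDiagEigenvalues P ξ η j).toNNReal := by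
  rw [AEMeasurable.map_map_of_aemeasurable (measurableEmbedding_diagCoord
    (isUnit_diagonalizer hξ hξu hη hηu)).measurable.aemeasurable hG.aemeasurable]
  refine map_mulVec_eq_pi_gaussianReal (Z := fun ω => Sum.elim (ξ ω) (η ω))
    (hG.map_fun (sumElimCLM p q)) _ _ ?_ ?_ _ (diagonalizer_mul_jointCov_mul hξ hξu hη hηu)
  · rintro (i | j) <;> rfl
  · rintro (i | i) (j | j)
    · rfl
    · rfl
    · simp [crossCov, covariance_comm]
    · rfl

/-- The product of the marginals is itself Gaussian with the same mean and with zero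
cross-covariance, so the same coordinates make it standard. -/
lemma map_diagCoord_prod [IsProbabilityMeasure P]
    (hG : HasGaussianLaw (fun ω => (ξ ω, η ω)) P)
    (hξ : (covMat P ξ).PosSemidef) (hξu : IsUnit (covMat P ξ))
    (hη : (covMat P η).PosSemidef) (hηu : IsUnit (covMat P η)) :
    ((P.map ξ).prod (P.map η)).map (diagCoord P ξ η) =
      Measure.pi fun _ => gaussianReal 0 1 := by
  have hGξ := hG.fst
  have hGη := hG.snd
  have := hGξ.isGaussian_map
  have := hGη.isGaussian_map
  have hid : HasGaussianLaw (fun x : (Fin p → ℝ) × (Fin q → ℝ) => x)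
      ((P.map ξ).prod (P.map η)) := IsGaussian.hasGaussianLaw_id
  have hL : ∀ i, MemLp (fun x : Fin p → ℝ => x i) 2 (P.map ξ) := fun i =>
    (IsGaussian.hasGaussianLaw_id (μ := P.map ξ)).eval i |>.memLp_two
  have hR : ∀ i, MemLp (fun x : Fin q → ℝ => x i) 2 (P.map η) := fun i =>
    (IsGaussian.hasGaussianLaw_id (μ := P.map η)).eval i |>.memLp_two
  have hfst := measurePreserving_fst (μ := P.map ξ) (ν := P.map η)
  have hsnd := measurePreserving_snd (μ := P.map ξ) (ν := P.map η)
  have hmeas : ∀ (n : ℕ) (i : Fin n) (μ : Measure (Fin n → ℝ)),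
      AEStronglyMeasurable (fun x : Fin n → ℝ => x i) μ := fun n i μ =>
    (measurable_pi_apply i).aestronglyMeasurable
  have h := map_mulVec_eq_pi_gaussianReal (Z := fun x : (Fin p → ℝ) × (Fin q → ℝ) =>
      (Sum.elim x.1 x.2 : Fin p ⊕ Fin q → ℝ)) (hid.map_fun (sumElimCLM p q)) (diagonalizer P ξ η)
      (jointMean P ξ η) ?_ (K := fromBlocks (covMat P ξ) 0 0 (covMat P η)) ?_ _
      (diagonalizer_mul_fromBlocks_mul hξ hξu hη hηu)
  · rw [Real.toNNReal_one] at h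
    exact h
  · rintro (i | j)
    · simp only [Sum.elim_inl, jointMean]
      rw [integral_fun_fst fun x : Fin p → ℝ => x i, probReal_univ, one_smul,
        integral_map hGξ.aemeasurable (hmeas _ _ _)]
    · simp only [Sum.elim_inr, jointMean]
      rw [integral_fun_snd fun x : Fin q → ℝ => x j, probReal_univ, one_smul,
        integral_map hGη.aemeasurable (hmeas _ _ _)]
  · rintro (i | i) (j | j)
    · simp only [Sum.elim_inl, fromBlocks_apply₁₁]
      rw [← covariance_map_fun (Z := Prod.fst) (X := fun x : Fin p → ℝ => x i)
        (Y := fun x : Fin p → ℝ => x j) (hmeas _ _ _) (hmeas _ _ _) hfst.aemeasurable, hfst.map_eq,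
        covariance_map_fun (hmeas _ _ _) (hmeas _ _ _) hGξ.aemeasurable]
      rfl
    · exact covariance_fst_snd_prod (hL i) (hR j)
    · simp only [Sum.elim_inl, Sum.elim_inr]
      rw [covariance_comm]
      exact covariance_fst_snd_prod (hL j) (hR i)
    · simp only [Sum.elim_inr, fromBlocks_apply₂₂]
      rw [← covariance_map_fun (Z := Prod.snd) (X := fun x : Fin q → ℝ => x i)
        (Y := fun x : Fin q → ℝ => x j) (hmeas _ _ _) (hmeas _ _ _) hsnd.aemeasurable, hsnd.map_eq,
        covariance_map_fun (hmeas _ _ _) (hmeas _ _ _) hGη.aemeasurable]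
      rfl

end Gaussian

/-! ### The information density as a quadratic form, and its characteristic function. -/

section GaussianLaw

variable {Ω : Type*} [MeasurableSpace Ω] {P : Measure Ω} {p q : ℕ}
  {ξ : Ω → Fin p → ℝ} {η : Ω → Fin q → ℝ}

/-- If `lam j ≤ 0`, then `toNNReal` truncates it to `0` and the `j`-th marginal is a point mass,
which is singular to the standard Gaussian. -/
lemma pos_of_pi_gaussianReal_absolutelyContinuous {ι : Type*} [Fintype ι] {lam : ι → ℝ}
    (h : Measure.pi (fun j => gaussianReal 0 (lam j).toNNReal) ≪
      Measure.pi fun _ : ι => gaussianReal 0 1) (j : ι) : 0 < lam j := by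
  by_contra hj
  have h1 := h.map (measurable_pi_apply j)
  rw [(measurePreserving_eval _ j).map_eq, (measurePreserving_eval _ j).map_eq,
    Real.toNNReal_of_nonpos (not_lt.1 hj), gaussianReal_zero_var] at h1
  have := nullSingletonClass_gaussianReal (μ := 0) (v := 1) one_ne_zero
  have h2 := h1 (measure_singleton (μ := gaussianReal 0 1) (0 : ℝ))
  simp at h2

lemma integral_sq_gaussianReal (v : NNReal) : ∫ w, w ^ 2 ∂(gaussianReal 0 v) = v := by
  rw [← variance_id_gaussianReal (μ := 0) (v := v), variance_of_integral_eq_zero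
    aemeasurable_id (by simp)]
  rfl

lemma integrable_sq_gaussianReal (v : NNReal) :
    Integrable (fun w => w ^ 2) (gaussianReal 0 v) :=
  (IsGaussian.memLp_two_id (μ := gaussianReal 0 v)).integrable_sq

/-- The centred information density as a quadratic form in the diagonal coordinates. -/
noncomputable def diagForm {ι : Type*} [Fintype ι] (lam : ι → ℝ) (w : ι → ℝ) : ℝ :=
  ∑ j, 1 / 2 * (1 - 1 / lam j) * w j ^ 2

lemma measurable_diagForm {ι : Type*} [Fintype ι] (lam : ι → ℝ) : Measurable (diagForm lam) := by
  unfold diagForm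
  fun_prop

lemma integrable_diagForm_and_integral {ι : Type*} [Fintype ι] {lam : ι → ℝ}
    (hlam : ∀ j, 0 < lam j) :
    Integrable (diagForm lam) (Measure.pi fun j => gaussianReal 0 (lam j).toNNReal) ∧
      ∫ w, diagForm lam w ∂(Measure.pi fun j => gaussianReal 0 (lam j).toNNReal) =
        ∑ j, 1 / 2 * (lam j - 1) := by
  have h1 : ∀ j, Integrable (fun w : ι → ℝ => 1 / 2 * (1 - 1 / lam j) * w j ^ 2)
      (Measure.pi fun j => gaussianReal 0 (lam j).toNNReal) := fun j =>
    ((measurePreserving_eval (fun j => gaussianReal 0 (lam j).toNNReal) j).integrable_comp_of_integrable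
      (integrable_sq_gaussianReal _)).const_mul _
  refine ⟨integrable_finsetSum _ fun j _ => h1 j, ?_⟩
  unfold diagForm
  rw [integral_finsetSum _ fun j _ => h1 j]
  refine Finset.sum_congr rfl fun j _ => ?_
  rw [integral_const_mul, integral_comp_eval (μ := fun j => gaussianReal 0 (lam j).toNNReal)
    (f := fun w => w ^ 2) (by fun_prop), integral_sq_gaussianReal, Real.coe_toNNReal _ (hlam j).le]
  have := (hlam j).ne'
  field_simp

/-- In the diagonal coordinates the density is a product of one-dimensional Gaussian ratios, whose
logarithms add up. -/
lemma infoDensity_ae_eq [IsProbabilityMeasure P]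
    (hG : HasGaussianLaw (fun ω => (ξ ω, η ω)) P)
    (hξ : (covMat P ξ).PosSemidef) (hξu : IsUnit (covMat P ξ))
    (hη : (covMat P η).PosSemidef) (hηu : IsUnit (covMat P η))
    (hac : P.map (fun ω => (ξ ω, η ω)) ≪ (P.map ξ).prod (P.map η))
    (hlam : ∀ j, 0 < 1 + offDiagEigenvalues P ξ η j) :
    infoDensity P ξ η =ᵐ[P] fun ω => (∑ j, -(1 / 2) * Real.log (1 + offDiagEigenvalues P ξ η j)) +
      diagForm (fun j => 1 + offDiagEigenvalues P ξ η j) (diagCoord P ξ η (ξ ω, η ω)) := by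
  have hW := measurableEmbedding_diagCoord (isUnit_diagonalizer hξ hξu hη hηu)
  have hGξ := hG.fst
  have hGη := hG.snd
  have := hGξ.isGaussian_map
  have := hGη.isGaussian_map
  have hr : ∀ v, Measurable fun w => ENNReal.ofReal (gaussianRatio v w) := fun v => by
    unfold gaussianRatio; fun_prop
  have hinst : ∀ j, SigmaFinite ((gaussianReal 0 1).withDensity fun w =>
      ENNReal.ofReal (gaussianRatio (1 + offDiagEigenvalues P ξ η j) w)) := fun j => by
    rw [← gaussianReal_eq_withDensity (hlam j)]
    infer_instance
  have h1 := map_diagCoord_joint hG hξ hξu hη hηu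
  simp_rw [fun j => gaussianReal_eq_withDensity (hlam j)] at h1
  rw [pi_withDensity_prod (fun _ => gaussianReal 0 1) fun j => hr _,
    ← map_diagCoord_prod hG hξ hξu hη hηu] at h1
  -- The derivative is identified almost everywhere for the product law; absolute continuity carries
  -- this over to the joint law.
  have h2 := hac.ae_eq (rnDeriv_of_map_eq_withDensity hW
    (Finset.measurable_fun_prod _ fun j _ => (hr _).comp (measurable_pi_apply j)) h1)
  filter_upwards [ae_of_ae_map hG.aemeasurable h2] with ω hω
  rw [infoDensity, hω]
  simp only [Function.comp_apply]
  rw [ENNReal.toReal_prod, Real.log_prod fun j _ => ?_, diagForm, ← Finset.sum_add_distrib]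
  · refine Finset.sum_congr rfl fun j _ => ?_
    rw [gaussianRatio, ENNReal.toReal_ofReal (Real.exp_pos _).le, Real.log_exp]
  · rw [gaussianRatio, ENNReal.toReal_ofReal (Real.exp_pos _).le]
    exact (Real.exp_pos _).ne'

lemma rank_whitenedCov (hξ : (covMat P ξ).PosSemidef) (hξu : IsUnit (covMat P ξ))
    (hη : (covMat P η).PosSemidef) (hηu : IsUnit (covMat P η)) :
    (whitenedCov P ξ η).rank = (crossCov P ξ η).rank := by
  rw [whitenedCov, Matrix.rank_mul_eq_left_of_isUnit_det _ _ (isUnit_det_invSqrt hη hηu),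
    Matrix.rank_mul_eq_right_of_isUnit_det _ _ (isUnit_det_invSqrt hξ hξu)]

/-- The characteristic function of the centred information density of a Gaussian pair. -/
theorem charFun_infoDensity_sub [IsProbabilityMeasure P]
    (hG : HasGaussianLaw (fun ω => (ξ ω, η ω)) P)
    (hξu : IsUnit (covMat P ξ)) (hηu : IsUnit (covMat P η))
    (hac : P.map (fun ω => (ξ ω, η ω)) ≪ (P.map ξ).prod (P.map η))
    {r : ℕ} (hr : r = (crossCov P ξ η).rank) :
    Integrable (infoDensity P ξ η) P ∧ ∀ t,
      charFun (P.map fun ω => infoDensity P ξ η ω - mutualInfo P ξ η) t =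
        ((∏ i ∈ Finset.range r, (1 + canonicalCorr P ξ η i ^ 2 * t ^ 2) ^ (-(1 / 2) : ℝ) : ℝ) :
          ℂ) := by
  have hξ : (covMat P ξ).PosSemidef := posSemidef_covMat fun i => (hG.fst.eval i).memLp_two
  have hη : (covMat P η).PosSemidef := posSemidef_covMat fun i => (hG.snd.eval i).memLp_two
  have hW := measurableEmbedding_diagCoord (isUnit_diagonalizer hξ hξu hη hηu)
  have hJ := map_diagCoord_joint hG hξ hξu hη hηu
  set lam : Fin p ⊕ Fin q → ℝ := fun j => 1 + offDiagEigenvalues P ξ η j with hlamdef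
  set π := Measure.pi fun j => gaussianReal 0 (lam j).toNNReal with hπ
  have hlam : ∀ j, 0 < lam j := by
    have h := hac.map hW.measurable
    rw [hJ, map_diagCoord_prod hG hξ hξu hη hηu] at h
    exact fun j => pos_of_pi_gaussianReal_absolutelyContinuous h j
  have hae := infoDensity_ae_eq hG hξ hξu hη hηu hac hlam
  have hWm : AEMeasurable (fun ω => diagCoord P ξ η (ξ ω, η ω)) P :=
    hW.measurable.comp_aemeasurable hG.aemeasurable
  have hJ' : P.map (fun ω => diagCoord P ξ η (ξ ω, η ω)) = π := by
    rw [← hJ, AEMeasurable.map_map_of_aemeasurable hW.measurable.aemeasurable hG.aemeasurable]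
    rfl
  obtain ⟨hint, hmean⟩ := integrable_diagForm_and_integral hlam
  -- The mean is half the sum of the eigenvalues, that is, half the trace of the block matrix.
  have hmean0 : ∫ w, diagForm lam w ∂π = 0 := by
    rw [hπ, hmean, ← Finset.mul_sum]
    simp only [hlamdef, add_sub_cancel_left]
    rw [show ∑ j, offDiagEigenvalues P ξ η j = 0 from sum_eigenvalues_offDiag _, mul_zero]
  have hintP : Integrable (fun ω => diagForm lam (diagCoord P ξ η (ξ ω, η ω))) P := by
    rw [← hπ, ← hJ'] at hint
    exact hint.comp_aemeasurable hWm
  have hI : mutualInfo P ξ η = ∑ j, -(1 / 2) * Real.log (lam j) := by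
    rw [mutualInfo, integral_congr_ae hae, integral_add (integrable_const _) hintP,
      ← integral_map hWm (measurable_diagForm lam).aestronglyMeasurable, hJ', hmean0]
    simp [hlamdef]
  refine ⟨(integrable_congr hae).2 ((integrable_const _).add hintP), ?_⟩
  have hlaw : P.map (fun ω => infoDensity P ξ η ω - mutualInfo P ξ η) = π.map (diagForm lam) := by
    rw [← hJ', AEMeasurable.map_map_of_aemeasurable (measurable_diagForm lam).aemeasurable hWm]
    refine Measure.map_congr ?_
    filter_upwards [hae] with ω hω
    rw [hω, hI, add_sub_cancel_left]
    rfl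
  have hrank : r = (whitenedCov P ξ η).rank := hr.trans (rank_whitenedCov hξ hξu hη hηu).symm
  have hpos : ∀ (i : ℕ) (t : ℝ), 0 < 1 + canonicalCorr P ξ η i ^ 2 * t ^ 2 := fun i t => by
    positivity
  have hsq : ∀ t : ℝ, charFun (π.map (diagForm lam)) t ^ 2 =
      ((∏ i ∈ Finset.range r, (1 + canonicalCorr P ξ η i ^ 2 * t ^ 2) ^ (-(1 / 2) : ℝ) : ℝ) :
          ℂ) ^ 2 := by
    intro t
    have h1 := sq_charFun_map_sum_sq hlam t
    have h2 := prod_one_sub_eigenvalues_offDiag (whitenedCov P ξ η) hrank (Complex.I * t)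
    have h3 : ∏ j, (1 - (Complex.I * t) * (lam j - 1 : ℝ)) =
        ((∏ i ∈ Finset.range r, (1 + canonicalCorr P ξ η i ^ 2 * t ^ 2) : ℝ) : ℂ) := by
      simp only [hlamdef, add_sub_cancel_left]
      refine h2.trans ?_
      rw [Complex.ofReal_prod]
      refine Finset.prod_congr rfl fun i _ => ?_
      rw [mul_pow, Complex.I_sq]
      push_cast
      simp only [canonicalCorr, whitenedCov]
      ring
    rw [h3] at h1
    have h4 : (∏ i ∈ Finset.range r, (1 + canonicalCorr P ξ η i ^ 2 * t ^ 2) ^ (-(1 / 2) : ℝ)) ^ 2 =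
        (∏ i ∈ Finset.range r, (1 + canonicalCorr P ξ η i ^ 2 * t ^ 2))⁻¹ := by
      rw [← Finset.prod_pow, ← Finset.prod_inv_distrib]
      refine Finset.prod_congr rfl fun i _ => ?_
      rw [← Real.rpow_mul_natCast (hpos i t).le]
      norm_num
      rw [Real.rpow_neg_one]
    rw [← Complex.ofReal_pow, h4, Complex.ofReal_inv]
    exact eq_inv_of_mul_eq_one_left h1
  have hprob : IsProbabilityMeasure (π.map (diagForm lam)) :=
    Measure.isProbabilityMeasure_map (measurable_diagForm lam).aemeasurable
  intro t
  rw [hlaw]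
  -- Two continuous functions on the line with equal squares, one of them nowhere zero, coincide
  -- once they agree at `0`.
  refine isPreconnected_univ.eq_of_sq_eq (f := charFun (π.map (diagForm lam)))
    (g := fun t : ℝ => ((∏ i ∈ Finset.range r, (1 + canonicalCorr P ξ η i ^ 2 * t ^ 2) ^
      (-(1 / 2) : ℝ) : ℝ) : ℂ)) continuous_charFun.continuousOn ?_ (fun t _ => hsq t)
      (fun {t} _ => ?_) (mem_univ (0 : ℝ)) ?_ (mem_univ t)
  · refine (Complex.continuous_ofReal.comp (continuous_finsetProd _ fun i _ => ?_)).continuousOn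
    exact Continuous.rpow_const (by fun_prop) fun t => Or.inl (hpos i t).ne'
  · exact_mod_cast (Finset.prod_pos fun i _ => Real.rpow_pos_of_pos (hpos i t) _).ne'
  · simp

end GaussianLaw

/-! ### From the multiple series to the single series. -/

section Series

variable {r : ℕ} {ρ : ℕ → ℝ}

lemma multiCoeff_eq (κ : Fin (r - 1) → ℕ) :
    multiCoeff r ρ κ = (∏ i : Fin (r - 1), ρ (r - 1) / ρ i) *
      ∏ i : Fin (r - 1), (((2 * κ i)! : ℕ) : ℝ) / (((κ i)! : ℝ) ^ 2 * 4 ^ κ i) *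
        (1 - ρ (r - 1) ^ 2 / ρ i ^ 2) ^ κ i := by
  rw [multiCoeff, ← Finset.prod_mul_distrib]
  exact Finset.prod_congr rfl fun i _ => by ring

/-- Grouping a multiple series with coefficients `multiCoeff` into a single series with
coefficients `delta`. -/
lemma summable_delta_mul_and_eq (hpos : 0 < ρ (r - 1)) (hle : ∀ i < r - 1, ρ (r - 1) ≤ ρ i)
    {a S : ℝ} (ha : a ≠ 0) {g : ℕ → ℝ}
    (h : HasSum (fun κ : Fin (r - 1) → ℕ => a * (multiCoeff r ρ κ * g (∑ i, κ i))) S) :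
    Summable (fun k => delta r ρ k * g k) ∧
      S = a * (∏ i : Fin (r - 1), ρ (r - 1) / ρ i) * ∑' k, delta r ρ k * g k := by
  set Q := ∏ i : Fin (r - 1), ρ (r - 1) / ρ i with hQ
  have hQ0 : Q ≠ 0 := Finset.prod_ne_zero_iff.2 fun i _ =>
    (div_pos hpos (hpos.trans_le (hle i i.2))).ne'
  have h1 := hasSum_antidiagonalTuple h
  have h2 : ∀ k, ∑ κ ∈ Finset.Nat.antidiagonalTuple (r - 1) k,
      a * (multiCoeff r ρ κ * g (∑ i, κ i)) = a * Q * (delta r ρ k * g k) := by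
    intro k
    rw [delta, Finset.sum_mul, Finset.mul_sum]
    refine Finset.sum_congr rfl fun κ hκ => ?_
    rw [Finset.Nat.mem_antidiagonalTuple.1 hκ, multiCoeff_eq]
    ring
  simp_rw [h2] at h1
  -- The nonzero prefactor `a * Q` can be divided out of the grouped series.
  have hs : Summable fun k => delta r ρ k * g k :=
    (summable_mul_left_iff (mul_ne_zero ha hQ0)).1 h1.summable
  exact ⟨hs, by rw [← tsum_mul_left, h1.tsum_eq]⟩

lemma besselDensity_eq_funU (hr : 2 ≤ r) (k : ℕ) (u : ℝ) :
    besselDensity (((r : ℝ) - 1) / 2 + k) u = 1 / √Real.pi * funU r k |u| := by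
  have hr' : (2 : ℝ) ≤ r := by exact_mod_cast hr
  have hν : 0 < ((r : ℝ) - 1) / 2 + k := by
    have : (0 : ℝ) ≤ k := Nat.cast_nonneg k
    linarith
  have e : ((r : ℝ) - 1) / 2 + k + 1 / 2 = (r : ℝ) / 2 + k := by ring
  rw [← besselDensity_abs]
  unfold funU
  split_ifs with h
  · rw [h, besselDensity_zero hν, e]
  · rw [besselDensity_eq_besselK _ ((abs_nonneg u).lt_of_ne' h), e]

end Series

section CanonicalCorr

variable {Ω : Type*} [MeasurableSpace Ω] {P : Measure Ω} {p q : ℕ}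
  {ξ : Ω → Fin p → ℝ} {η : Ω → Fin q → ℝ}

/-- The canonical correlations of index less than the rank are positive, and they decrease. -/
lemma canonicalCorr_pos_and_le [IsProbabilityMeasure P]
    (hG : HasGaussianLaw (fun ω => (ξ ω, η ω)) P)
    (hξu : IsUnit (covMat P ξ)) (hηu : IsUnit (covMat P η))
    {r : ℕ} (hr : r = (crossCov P ξ η).rank) (hr1 : 1 ≤ r) :
    0 < canonicalCorr P ξ η (r - 1) ∧
      ∀ i < r - 1, canonicalCorr P ξ η (r - 1) ≤ canonicalCorr P ξ η i := by
  have hξ : (covMat P ξ).PosSemidef := posSemidef_covMat fun i => (hG.fst.eval i).memLp_two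
  have hη : (covMat P η).PosSemidef := posSemidef_covMat fun i => (hG.snd.eval i).memLp_two
  refine ⟨(LinearMap.singularValues_pos_iff_lt_finrank_range _).2 ?_,
    fun i hi => LinearMap.singularValues_antitone _ hi.le⟩
  rw [← rank_eq_finrank_range_toEuclideanLin]
  change r - 1 < (whitenedCov P ξ η).rank
  rw [rank_whitenedCov hξ hξu hη hηu, ← hr]
  omega

end CanonicalCorr

/-! ### Scaling and reflection of the mixture. -/

section Law

variable {r : ℕ} {ρ : ℕ → ℝ}

lemma map_mixMeasure_eq_withDensity (hr : 2 ≤ r) (hpos : 0 < ρ (r - 1))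
    (hle : ∀ i < r - 1, ρ (r - 1) ≤ ρ i) (I : ℝ) :
    (mixMeasure r ρ).map (fun u => ρ (r - 1) * u + I) = volume.withDensity fun x =>
      ENNReal.ofReal (1 / ρ (r - 1) * mixDensity r ρ ((x - I) / ρ (r - 1))) := by
  set s := ρ (r - 1)
  have hφ : Measurable fun u : ℝ => s * u + I := by fun_prop
  have hvol : (volume : Measure ℝ).map (fun u => s * u + I) = ENNReal.ofReal s⁻¹ • volume := by
    have h1 : (fun u : ℝ => s * u + I) = (fun x => x + I) ∘ fun u => s * u := rfl
    rw [h1, ← Measure.map_map (by fun_prop) (by fun_prop), Real.map_volume_mul_left hpos.ne',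
      Measure.map_smul, map_add_right_eq_self, abs_of_pos (inv_pos.2 hpos)]
  have hm : Measurable fun x : ℝ => ENNReal.ofReal (1 / s * mixDensity r ρ ((x - I) / s)) := by
    have := (continuous_mixDensity hr hpos hle).measurable
    fun_prop
  ext A hA
  rw [Measure.map_apply hφ hA, mixMeasure, withDensity_apply _ (hφ hA), withDensity_apply _ hA]
  have h2 : ∀ u : ℝ, ENNReal.ofReal (mixDensity r ρ u) = ENNReal.ofReal s *
      ENNReal.ofReal (1 / s * mixDensity r ρ ((s * u + I - I) / s)) := by
    intro u
    rw [← ENNReal.ofReal_mul hpos.le, add_sub_cancel_right, mul_div_cancel_left₀ _ hpos.ne',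
      ← mul_assoc, mul_one_div_cancel hpos.ne', one_mul]
  simp_rw [h2]
  have hmφ : Measurable fun u : ℝ =>
      ENNReal.ofReal (1 / s * mixDensity r ρ ((s * u + I - I) / s)) := hm.comp hφ
  rw [lintegral_const_mul _ hmφ, ← setLIntegral_map (μ := volume) hA hm hφ, hvol,
    Measure.restrict_smul, lintegral_smul_measure, smul_eq_mul, ← mul_assoc, ← ENNReal.ofReal_mul hpos.le,
    mul_inv_cancel₀ hpos.ne', ENNReal.ofReal_one, one_mul]

lemma intervalIntegral_mixDensity_neg (w : ℝ) :
    ∫ u in (0 : ℝ)..(-w), mixDensity r ρ u = -∫ u in (0 : ℝ)..w, mixDensity r ρ u := by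
  have h := intervalIntegral.integral_comp_neg (a := 0) (b := w) (mixDensity r ρ)
  simp only [mixDensity_neg, neg_zero] at h
  rw [h, intervalIntegral.integral_symm]

end Law

end GaussInfo

/-! ### Density and distribution function of the information density. -/

theorem mainTheorem10 {Ω : Type*} [MeasurableSpace Ω] (P : Measure Ω) [IsProbabilityMeasure P]
    {p q : ℕ} (ξ : Ω → Fin p → ℝ) (η : Ω → Fin q → ℝ)
    (hGauss : HasGaussianLaw (fun ω => (ξ ω, η ω)) P)
    (hξ : IsUnit (GaussInfo.covMat P ξ)) (hη : IsUnit (GaussInfo.covMat P η))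
    (hac : P.map (fun ω => (ξ ω, η ω)) ≪ (P.map ξ).prod (P.map η))
    (r : ℕ) (hr : r = (GaussInfo.crossCov P ξ η).rank) (hr2 : 2 ≤ r)
    (ρ : ℕ → ℝ) (hρ : ρ = GaussInfo.canonicalCorr P ξ η)
    (I : ℝ) (hI : I = GaussInfo.mutualInfo P ξ η) :
    Integrable (GaussInfo.infoDensity P ξ η) P ∧
    -- the probability density function
    (∃ f : ℝ → ℝ, Continuous f ∧ (∀ x, 0 ≤ f x) ∧
      P.map (GaussInfo.infoDensity P ξ η) = volume.withDensity (fun x => ENNReal.ofReal (f x)) ∧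
      -- multiple series
      (∀ x, x ≠ I →
        HasSum (fun κ : Fin (r - 1) → ℕ =>
          1 / (ρ (r - 1) * √Real.pi) * (GaussInfo.multiCoeff r ρ κ *
            (GaussInfo.besselK (((r : ℝ) - 1) / 2 + ∑ i, (κ i : ℝ)) |(x - I) / ρ (r - 1)| /
              Real.Gamma ((r : ℝ) / 2 + ∑ i, (κ i : ℝ)) *
              |(x - I) / (2 * ρ (r - 1))| ^ (((r : ℝ) - 1) / 2 + ∑ i, (κ i : ℝ))))) (f x)) ∧
      -- alternative single series
      (∀ x,
        Summable (fun k : ℕ => GaussInfo.delta r ρ k *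
          GaussInfo.funU r k |(x - I) / ρ (r - 1)|) ∧
        f x = 1 / (ρ (r - 1) * √Real.pi) * (∏ i : Fin (r - 1), ρ (r - 1) / ρ i) *
          ∑' k : ℕ, GaussInfo.delta r ρ k * GaussInfo.funU r k |(x - I) / ρ (r - 1)|)) ∧
    -- the cumulative distribution function
    (∃ V : ℝ → ℝ,
      (∀ x, x ≤ I → P.real {ω | GaussInfo.infoDensity P ξ η ω ≤ x} = 1 / 2 - V (I - x)) ∧
      (∀ x, I < x → P.real {ω | GaussInfo.infoDensity P ξ η ω ≤ x} = 1 / 2 + V (x - I)) ∧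
      -- multiple series
      (∀ z, 0 ≤ z →
        HasSum (fun κ : Fin (r - 1) → ℕ =>
          GaussInfo.multiCoeff r ρ κ * (z / (2 * ρ (r - 1)) *
            (GaussInfo.besselK (((r : ℝ) - 1) / 2 + ∑ i, (κ i : ℝ)) (z / ρ (r - 1)) *
                GaussInfo.struveL (((r : ℝ) - 3) / 2 + ∑ i, (κ i : ℝ)) (z / ρ (r - 1)) +
              GaussInfo.besselK (((r : ℝ) - 3) / 2 + ∑ i, (κ i : ℝ)) (z / ρ (r - 1)) *
                GaussInfo.struveL (((r : ℝ) - 1) / 2 + ∑ i, (κ i : ℝ)) (z / ρ (r - 1))))) (V z)) ∧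
      -- alternative single series
      (∀ z, 0 ≤ z →
        Summable (fun k : ℕ => GaussInfo.delta r ρ k *
          GaussInfo.funD r (ρ (r - 1)) k z) ∧
        V z = (∏ i : Fin (r - 1), ρ (r - 1) / ρ i) *
          ∑' k : ℕ, GaussInfo.delta r ρ k * GaussInfo.funD r (ρ (r - 1)) k z)) := by
  obtain ⟨hint, hchar⟩ := GaussInfo.charFun_infoDensity_sub hGauss hξ hη hac hr
  obtain ⟨hpos, hle⟩ := GaussInfo.canonicalCorr_pos_and_le hGauss hξ hη hr (by omega)
  rw [← hρ] at hpos hle hchar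
  rw [← hI] at hchar
  have hprob := GaussInfo.isProbabilityMeasure_mixMeasure hr2 hpos hle
  have hYm : AEMeasurable (fun ω => GaussInfo.infoDensity P ξ η ω - I) P :=
    hint.aestronglyMeasurable.aemeasurable.sub_const I
  -- Scaling by `ρ (r - 1)` replaces `t` by `ρ (r - 1) * t`, which cancels the denominators in
  -- `charFun_mixMeasure`.
  have hlaw : P.map (fun ω => GaussInfo.infoDensity P ξ η ω - I) =
      (GaussInfo.mixMeasure r ρ).map (fun u => ρ (r - 1) * u) := by
    have := Measure.isProbabilityMeasure_map hYm
    have : IsProbabilityMeasure ((GaussInfo.mixMeasure r ρ).map (fun u => ρ (r - 1) * u)) :=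
      Measure.isProbabilityMeasure_map (by fun_prop)
    refine Measure.ext_of_charFun ?_
    ext t
    rw [hchar, charFun_map_mul, GaussInfo.charFun_mixMeasure hr2 hpos hle]
    congr 1
    refine Finset.prod_congr rfl fun i _ => ?_
    congr 2
    rw [div_pow, mul_pow]
    field_simp
  have hcast : ∀ κ : Fin (r - 1) → ℕ, ∑ i, (κ i : ℝ) = ((∑ i, κ i : ℕ) : ℝ) := fun κ => by
    push_cast; rfl
  have hcdf : ∀ x, P.real {ω | GaussInfo.infoDensity P ξ η ω ≤ x} =
      1 / 2 + ∫ u in (0 : ℝ)..((x - I) / ρ (r - 1)), GaussInfo.mixDensity r ρ u := by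
    intro x
    have e1 : {ω | GaussInfo.infoDensity P ξ η ω ≤ x} =
        (fun ω => GaussInfo.infoDensity P ξ η ω - I) ⁻¹' Set.Iic (x - I) := by
      ext ω
      simp
    have e2 : (fun u => ρ (r - 1) * u) ⁻¹' Set.Iic (x - I) = Set.Iic ((x - I) / ρ (r - 1)) := by
      ext u
      simp only [Set.mem_preimage, Set.mem_Iic, le_div_iff₀ hpos, mul_comm]
    rw [← GaussInfo.mixMeasure_real_Iic hr2 hpos hle, e1, Measure.real, Measure.real,
      ← Measure.map_apply_of_aemeasurable hYm measurableSet_Iic, hlaw,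
      Measure.map_apply (by fun_prop) measurableSet_Iic, e2]
  have hterm : ∀ x (κ : Fin (r - 1) → ℕ), 1 / ρ (r - 1) * (GaussInfo.multiCoeff r ρ κ *
      GaussInfo.besselDensity (((r : ℝ) - 1) / 2 + ∑ i, (κ i : ℝ)) ((x - I) / ρ (r - 1))) =
      1 / (ρ (r - 1) * √Real.pi) * (GaussInfo.multiCoeff r ρ κ *
        GaussInfo.funU r (∑ i, κ i) |(x - I) / ρ (r - 1)|) := by
    intro x κ
    rw [hcast, GaussInfo.besselDensity_eq_funU hr2]
    field_simp
  have hsum : ∀ x, HasSum (fun κ : Fin (r - 1) → ℕ => 1 / (ρ (r - 1) * √Real.pi) *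
      (GaussInfo.multiCoeff r ρ κ * GaussInfo.funU r (∑ i, κ i) |(x - I) / ρ (r - 1)|))
      (1 / ρ (r - 1) * GaussInfo.mixDensity r ρ ((x - I) / ρ (r - 1))) := by
    intro x
    have h := (GaussInfo.hasSum_mixDensity hr2 hpos hle ((x - I) / ρ (r - 1))).mul_left (1 / ρ (r - 1))
    simpa only [hterm] using h
  have hV : ∀ z, 0 ≤ z → HasSum (fun κ : Fin (r - 1) → ℕ => GaussInfo.multiCoeff r ρ κ *
      GaussInfo.funD r (ρ (r - 1)) (∑ i, κ i) z) (∫ u in (0 : ℝ)..(z / ρ (r - 1)), GaussInfo.mixDensity r ρ u) := by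
    intro z hz
    -- At `z = 0` the prefactor `z / (2 * ρ (r - 1))` annihilates every term, whatever `besselK`
    -- returns there.
    rcases hz.eq_or_lt with rfl | hz
    · simp [GaussInfo.funD]
    · have h := GaussInfo.hasSum_integral_mixDensity hr2 hpos hle (div_pos hz hpos)
      have e : z / ρ (r - 1) / 2 = z / (2 * ρ (r - 1)) := by rw [div_div, mul_comm]
      simp only [hcast, e] at h
      exact h
  refine ⟨hint, ⟨fun x => 1 / ρ (r - 1) * GaussInfo.mixDensity r ρ ((x - I) / ρ (r - 1)), ?_, fun x => ?_, ?_,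
    fun x hx => ?_, fun x => ?_⟩,
    ⟨fun z => ∫ u in (0 : ℝ)..(z / ρ (r - 1)), GaussInfo.mixDensity r ρ u, fun x _ => ?_, fun x _ => hcdf x,
      fun z hz => ?_, fun z hz => ?_⟩⟩
  · exact continuous_const.mul ((GaussInfo.continuous_mixDensity hr2 hpos hle).comp (by fun_prop))
  · exact mul_nonneg (by positivity) (GaussInfo.mixDensity_nonneg hr2 hpos hle _)
  · rw [← GaussInfo.map_mixMeasure_eq_withDensity hr2 hpos hle I]
    have e : (fun u => ρ (r - 1) * u + I) = (fun x => x + I) ∘ fun u => ρ (r - 1) * u := rfl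
    rw [e, ← Measure.map_map (by fun_prop) (by fun_prop), ← hlaw,
      AEMeasurable.map_map_of_aemeasurable (by fun_prop) hYm]
    congr 1
    ext ω
    simp
  -- Away from `I` the function `funU` takes its Bessel branch, not the limiting value at `0`.
  · have hne : |(x - I) / ρ (r - 1)| ≠ 0 := abs_ne_zero.2 (div_ne_zero (sub_ne_zero.2 hx) hpos.ne')
    have e : |(x - I) / ρ (r - 1)| / 2 = |(x - I) / (2 * ρ (r - 1))| := by
      rw [abs_div, abs_div, abs_mul, abs_two, div_div, mul_comm]
    have h := hsum x
    simp only [GaussInfo.funU, if_neg hne, e, ← hcast] at h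
    exact h
  · exact GaussInfo.summable_delta_mul_and_eq hpos hle
      (g := fun k => GaussInfo.funU r k |(x - I) / ρ (r - 1)|) (by positivity) (hsum x)
  -- Evenness of the mixture density makes its integral from `0` odd, which gives the minus sign for
  -- `x ≤ I`.
  · rw [hcdf, show (x - I) / ρ (r - 1) = -((I - x) / ρ (r - 1)) by ring,
      GaussInfo.intervalIntegral_mixDensity_neg]
    ring
  · have h := hV z hz
    simp only [GaussInfo.funD, ← hcast] at h
    exact h
  · have h := GaussInfo.summable_delta_mul_and_eq hpos hle (a := 1)
      (g := fun k => GaussInfo.funD r (ρ (r - 1)) k z) one_ne_zero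
      (by simpa only [one_mul] using hV z hz)
    simpa only [one_mul] using h
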